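/- Consider online scheduling on $m$ unrelated machines. Finitely many jobs arrive over time; job $j$ has release time $r_j\ge 0$, weight $w_j>0$, processing length $p_j>0$ and rates $\ell_{ij}\in[0,\infty)$. At each time $t\ge 0$ machine $i$ runs at some speed $S(i,t)\ge 0$, consuming power $f(S(i,t))$, and splits its speed among released, uncompleted jobs: job $j$ receives a share $\nu_{ij}(t)\ge 0$ with $\sum_j\nu_{ij}(t)\le S(i,t)$, and is then processed at rate $\ell_{ij}\nu_{ij}(t)$. At every instant a job may be processed on at most one machine; preemption and migration are free. Let $C_j$ be the first time at which job $j$ has received total processing $p_j$ ($C_j=\infty$ if there is none). The objective is the total weighted flow-time plus energy $$\sum_j w_j (C_j-r_j)+\sum_i\int_0^\infty f(S(i,t))\,dt .$$ A non-clairvoyant algorithm learns $w_j$ and all $\ell_{ij}$ when job $j$ is released, and never sees $p_j$: its decisions at time $t$ depend only on the jobs released up to time $t$ (their release times, weights and rates) and on which of them have completed up to time $t$, and when. It is $c$-competitive if on every instance its cost is at most $c$ times the infimum of the costs of all feasible (offline) schedules of that instance, with no resource augmentation. **Corollary.** There is an absolute constant $C>0$ such that for every $\gamma>1$ and every number $m$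 of machines, when every machine has power function $f(s)=s^\gamma$, there is a $C\gamma^2$-competitive non-clairvoyant algorithm for total weighted flow-time plus energy. -/

import Mathlib

open MeasureTheory
open scoped NNReal ENNReal

namespace FlowEnergy

/-- An instance of the scheduling problem on `m` unrelated machines: a finite set of jobs
(labelled by natural numbers); job `j` is released at time `release j`, has weight `weight j` and
processing length `size j`, and is processed on machine `i`, per unit of speed devoted to it,
at rate `eff i j` (the value `0` is allowed). Values at labels outside `jobs` are irrelevant. -/
structure JobInstance (m : ℕ) where
  jobs : Finset ℕ
  release : ℕ → ℝ≥0
  weight : ℕ → ℝ≥0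
  size : ℕ → ℝ≥0
  eff : Fin m → ℕ → ℝ≥0
  weight_pos : ∀ j ∈ jobs, 0 < weight j
  size_pos : ∀ j ∈ jobs, 0 < size j

/-- The raw data of a schedule: `speed i t` is the speed of machine `i` at time `t`, and
`share i j t` is the part of this speed that machine `i` devotes to job `j`. -/
structure Schedule (m : ℕ) where
  speed : Fin m → ℝ → ℝ≥0
  share : Fin m → ℕ → ℝ → ℝ≥0

variable {m : ℕ}

/-- The amount of job `j` that has been processed by time `t`. -/
noncomputable def work (I : JobInstance m) (S : Schedule m) (j : ℕ) (t : ℝ) : ℝ≥0∞ :=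
  ∑ i : Fin m, ∫⁻ u in Set.Icc (I.release j : ℝ) t, ((I.eff i j * S.share i j u : ℝ≥0) : ℝ≥0∞)

/-- Job `j` is completed at time `t` or earlier. -/
def CompletedBy (I : JobInstance m) (S : Schedule m) (j : ℕ) (t : ℝ) : Prop :=
  (I.release j : ℝ) ≤ t ∧ (I.size j : ℝ≥0∞) ≤ work I S j t

/-- Job `j` is active at time `t`: it has been released and is not yet completed. -/
def Active (I : JobInstance m) (S : Schedule m) (j : ℕ) (t : ℝ) : Prop :=
  j ∈ I.jobs ∧ (I.release j : ℝ) ≤ t ∧ ¬ CompletedBy I S j t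

/-- Feasible schedules. Preemption and migration are free and unrestricted. -/
structure IsFeasible (I : JobInstance m) (S : Schedule m) : Prop where
  measurable_speed : ∀ i, Measurable (S.speed i)
  measurable_share : ∀ i j, Measurable (S.share i j)
  /-- A machine delivers a finite amount of processing in bounded time. -/
  locally_integrable : ∀ (i : Fin m) (T : ℝ), ∫⁻ t in Set.Icc 0 T, (S.speed i t : ℝ≥0∞) ≠ ∞
  /-- The speed of a machine is divided among the jobs. -/
  sum_share_le : ∀ i t, ∑ j ∈ I.jobs, S.share i j t ≤ S.speed i t
  /-- At every instant a job is processed on at most one machine. -/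
  one_machine : ∀ j t i i', S.share i j t ≠ 0 → S.share i' j t ≠ 0 → i = i'
  /-- Only active jobs are processed. -/
  share_eq_zero : ∀ i j t, ¬ Active I S j t → S.share i j t = 0

/-- The flow-time of job `j`, i.e. completion time minus release time; it is `∞` if the job is
never completed. -/
noncomputable def flowTime (I : JobInstance m) (S : Schedule m) (j : ℕ) : ℝ≥0∞ :=
  ⨅ (d : ℝ≥0) (_ : CompletedBy I S j (I.release j + d)), (d : ℝ≥0∞)

/-- The total energy consumed, where machine `i` running at speed `s` uses power `f i s`. -/
noncomputable def energy (f : Fin m → ℝ≥0 → ℝ≥0) (S : Schedule m) : ℝ≥0∞ :=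
  ∑ i : Fin m, ∫⁻ t in Set.Ici (0 : ℝ), (f i (S.speed i t) : ℝ≥0∞)

/-- The objective: total weighted flow-time plus total energy. -/
noncomputable def cost (f : Fin m → ℝ≥0 → ℝ≥0) (I : JobInstance m) (S : Schedule m) : ℝ≥0∞ :=
  ∑ j ∈ I.jobs, (I.weight j : ℝ≥0∞) * flowTime I S j + energy f S

/-- The offline optimum: the infimum of the cost over all feasible schedules. -/
noncomputable def opt (f : Fin m → ℝ≥0 → ℝ≥0) (I : JobInstance m) : ℝ≥0∞ :=
  ⨅ (S : Schedule m) (_ : IsFeasible I S), cost f I S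

/-- What a non-clairvoyant scheduler can see up to (and including) time `t` is the same in the
instance `I` run under `S` and in the instance `I'` run under `S'`: the same jobs have been
released, with the same release times, weights and processing rates, and each of these jobs has
been completed at the same times. The sizes are not seen. -/
structure SameHistory (I : JobInstance m) (S : Schedule m) (I' : JobInstance m) (S' : Schedule m)
    (t : ℝ) : Prop where
  released_iff : ∀ j, (j ∈ I.jobs ∧ (I.release j : ℝ) ≤ t) ↔
    (j ∈ I'.jobs ∧ (I'.release j : ℝ) ≤ t)
  release_eq : ∀ j ∈ I.jobs, (I.release j : ℝ) ≤ t → I.release j = I'.release j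
  weight_eq : ∀ j ∈ I.jobs, (I.release j : ℝ) ≤ t → I.weight j = I'.weight j
  eff_eq : ∀ j ∈ I.jobs, (I.release j : ℝ) ≤ t → ∀ i, I.eff i j = I'.eff i j
  completed_iff : ∀ j ∈ I.jobs, (I.release j : ℝ) ≤ t → ∀ u ≤ t,
    (CompletedBy I S j u ↔ CompletedBy I' S' j u)

/-- A (deterministic, online) non-clairvoyant algorithm: it produces a feasible schedule for every
instance, and its decisions at time `t` depend only on what has been seen up to time `t`. -/
structure NonclairvoyantAlgorithm (m : ℕ) where
  run : JobInstance m → Schedule m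
  feasible : ∀ I, IsFeasible I (run I)
  nonanticipating : ∀ I I' t, SameHistory I (run I) I' (run I') t →
    (∀ i, (run I).speed i t = (run I').speed i t) ∧
    (∀ i j, (run I).share i j t = (run I').share i j t)

/-- The algorithm is `c`-competitive (without resource augmentation) for weighted flow-time plus
energy with the power functions `f i`. -/
def NonclairvoyantAlgorithm.IsCompetitive (A : NonclairvoyantAlgorithm m)
    (f : Fin m → ℝ≥0 → ℝ≥0) (c : ℝ≥0∞) : Prop :=
  ∀ I : JobInstance m, cost f I (A.run I) ≤ c * opt f I

end FlowEnergy

namespace FlowEnergy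

variable {m : ℕ}

/-! The algorithm keeps a queue on every machine. Write `W` for the weight in a queue and `x`, `y`
for the weight up to job `j` with and without `j`. The machine runs at speed `W ^ (1 / γ)`, so its
power is `W`, and `j` gets the fraction `(x ^ (2γ) - y ^ (2γ)) / W ^ (2γ)` of it. With `δ = 1 - 1 /
γ`, the utility of `j` on machine `i` is `eff i j / x ^ δ`. Whenever the active set changes, the
queues are rearranged into an equilibrium in which no job gains by moving to the tail of a queue and
no surviving job is worse off; a potential argument gives one (`Config.exists_equil`). Sizes play no
role, so the algorithm is non-clairvoyant.

Since power equals load, the cost is at most `2V`, where `V` is the integral of the total load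
(`cost_sched_le`). `V` is bounded by dual fitting. The dual density of `j` is `x ^ δ / (2γ)` times
its share. It is at most the weight of `j` (`Config.dual_le`), and over one queue it sums to at
least `W / (2γ + δ)` (`Config.le_sum_dual_queue`). Equilibrium at time `t` and monotone utilities
bound `eff i j` times the density at any `u ≥ t` by `(W + w) ^ δ / (2γ)` times the processing rate
at `u`, with `W` the load of `i` at time `t` and `w` the weight of `j` (`eff_mul_dualAt_le`).
Integrated over `u`, the rate contributes at most the size of `j`.

This constraint is integrated against the work of an arbitrary feasible schedule, and Young's
inequality splits the products of shares with `W ^ δ` and `w ^ δ` into energy, flow-time and `δ V /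
(2γ)`. The coefficient of `V` on the dual side exceeds `δ / (2γ)` by at least `1 / (6γ²)`
(`coefficient_le`). Hence `V` is at most `12γ²` times the cost of that schedule, which gives the
ratio `24γ²`.

The queues depend on completion times, which depend on the schedule; `exists_completionTimes`
resolves this circularity one completion at a time. -/

/-- The weight of the elements of `B` of rank at most that of `j`. -/
noncomputable def frontOf (w : ℕ → ℝ≥0) (B : Finset ℕ) (rank : ℕ → ℕ) (j : ℕ) : ℝ≥0 :=
  ∑ l ∈ B with rank l ≤ rank j, w l

/-- The weight of the elements of `B` of rank smaller than that of `j`. -/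
noncomputable def beforeOf (w : ℕ → ℝ≥0) (B : Finset ℕ) (rank : ℕ → ℕ) (j : ℕ) : ℝ≥0 :=
  ∑ l ∈ B with rank l < rank j, w l

/-! ### Prefix weights along a queue. -/

section Queue

variable {w : ℕ → ℝ≥0} {B : Finset ℕ} {rank : ℕ → ℕ} {j : ℕ}

lemma frontOf_le_sum : frontOf w B rank j ≤ ∑ l ∈ B, w l :=
  Finset.sum_le_sum_of_subset (Finset.filter_subset _ _)

lemma le_frontOf (hj : j ∈ B) : w j ≤ frontOf w B rank j :=
  Finset.single_le_sum (f := w) (fun _ _ => zero_le) (by simp [hj])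

lemma frontOf_eq (hr : Set.InjOn rank B) (hj : j ∈ B) :
    frontOf w B rank j = beforeOf w B rank j + w j := by
  have : (B.filter fun l => rank l ≤ rank j) = insert j (B.filter fun l => rank l < rank j) := by
    ext l
    simp only [Finset.mem_filter, Finset.mem_insert]
    constructor
    · rintro ⟨h1, h2⟩
      rcases h2.lt_or_eq with h | h
      · exact Or.inr ⟨h1, h⟩
      · exact Or.inl (hr h1 hj h)
    · rintro (rfl | ⟨h1, h2⟩)
      · exact ⟨hj, le_rfl⟩
      · exact ⟨h1, h2.le⟩
  rw [frontOf, this, Finset.sum_insert (by simp), beforeOf, add_comm]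

lemma frontOf_insert_of_lt {a : ℕ} (h : rank j < rank a) :
    frontOf w (insert a B) rank j = frontOf w B rank j := by
  rw [frontOf, Finset.filter_insert, if_neg (by omega), frontOf]

lemma beforeOf_insert_of_lt {a : ℕ} (h : rank j < rank a) :
    beforeOf w (insert a B) rank j = beforeOf w B rank j := by
  rw [beforeOf, Finset.filter_insert, if_neg (by omega), beforeOf]

lemma frontOf_of_max (h : ∀ l ∈ B, rank l ≤ rank j) : frontOf w B rank j = ∑ l ∈ B, w l := by
  rw [frontOf, Finset.filter_true_of_mem h]

/-- Telescoping along a queue. -/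
lemma sum_telescope_le (w : ℕ → ℝ≥0) (B : Finset ℕ) (rank : ℕ → ℕ) (hr : Set.InjOn rank B)
    (G : ℝ≥0 → ℝ≥0) (φ : ℝ≥0 → ℝ≥0 → ℝ≥0) (h : ∀ x y, y ≤ x → G x ≤ G y + φ x y) :
    G (∑ l ∈ B, w l) ≤
      G 0 + ∑ j ∈ B, φ (frontOf w B rank j) (beforeOf w B rank j) := by
  classical
  induction B using Finset.induction_on_max_value rank with
  | empty => simp
  | insert a s ha hmax ih =>
    have hlt : ∀ l ∈ s, rank l < rank a := fun l hl =>
      lt_of_le_of_ne (hmax l hl) fun e => ha (hr (by simp [hl]) (by simp) e ▸ hl)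
    have ih := ih (hr.mono (by simp))
    have h1 : frontOf w (insert a s) rank a = ∑ l ∈ insert a s, w l :=
      frontOf_of_max (by simpa using fun l hl => (hlt l hl).le)
    have h2 : beforeOf w (insert a s) rank a = ∑ l ∈ s, w l := by
      rw [beforeOf, Finset.filter_insert, if_neg (by simp), Finset.filter_true_of_mem hlt]
    have h3 : ∑ j ∈ s, φ (frontOf w (insert a s) rank j) (beforeOf w (insert a s) rank j) =
        ∑ j ∈ s, φ (frontOf w s rank j) (beforeOf w s rank j) :=
      Finset.sum_congr rfl fun j hj => by
        rw [frontOf_insert_of_lt (hlt j hj), beforeOf_insert_of_lt (hlt j hj)]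
    rw [Finset.sum_insert (s := s)
      (f := fun j => φ (frontOf w (Insert.insert a s) rank j) _) ha, h1, h2, h3]
    refine (h _ (∑ l ∈ s, w l) (Finset.sum_le_sum_of_subset (by simp))).trans ?_
    rw [add_left_comm, add_comm]
    gcongr

lemma sum_telescope_ge (w : ℕ → ℝ≥0) (B : Finset ℕ) (rank : ℕ → ℕ) (hr : Set.InjOn rank B)
    (G : ℝ≥0 → ℝ≥0) (φ : ℝ≥0 → ℝ≥0 → ℝ≥0) (h : ∀ x y, y ≤ x → G y + φ x y ≤ G x) :
    G 0 + ∑ j ∈ B, φ (frontOf w B rank j) (beforeOf w B rank j) ≤ G (∑ l ∈ B, w l) := by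
  classical
  induction B using Finset.induction_on_max_value rank with
  | empty => simp
  | insert a s ha hmax ih =>
    have hlt : ∀ l ∈ s, rank l < rank a := fun l hl =>
      lt_of_le_of_ne (hmax l hl) fun e => ha (hr (by simp [hl]) (by simp) e ▸ hl)
    have ih := ih (hr.mono (by simp))
    have h1 : frontOf w (insert a s) rank a = ∑ l ∈ insert a s, w l :=
      frontOf_of_max (by simpa using fun l hl => (hlt l hl).le)
    have h2 : beforeOf w (insert a s) rank a = ∑ l ∈ s, w l := by
      rw [beforeOf, Finset.filter_insert, if_neg (by simp), Finset.filter_true_of_mem hlt]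
    have h3 : ∑ j ∈ s, φ (frontOf w (insert a s) rank j) (beforeOf w (insert a s) rank j) =
        ∑ j ∈ s, φ (frontOf w s rank j) (beforeOf w s rank j) :=
      Finset.sum_congr rfl fun j hj => by
        rw [frontOf_insert_of_lt (hlt j hj), beforeOf_insert_of_lt (hlt j hj)]
    rw [Finset.sum_insert (s := s)
      (f := fun j => φ (frontOf w (Insert.insert a s) rank j) _) ha, h1, h2, h3]
    refine le_trans ?_ (h _ (∑ l ∈ s, w l) (Finset.sum_le_sum_of_subset (by simp)))
    rw [add_left_comm, add_comm]
    gcongr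

end Queue

/-! ### Inequalities for real powers. -/

/-- Young's inequality in the form used for the power function `s ^ γ`. -/
lemma mul_rpow_le_young {γ : ℝ} (hγ : 1 < γ) (s x : ℝ≥0) :
    s * x ^ (1 - 1 / γ) ≤ (1 / γ).toNNReal * s ^ γ + (1 - 1 / γ).toNNReal * x := by
  have h0 : (0 : ℝ) < γ := by linarith
  have h1 : 0 ≤ 1 - 1 / γ := by
    rw [sub_nonneg, div_le_one h0]; exact hγ.le
  have := NNReal.geom_mean_le_arith_mean2_weighted (1 / γ).toNNReal (1 - 1 / γ).toNNReal (s ^ γ) x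
    (by rw [← Real.toNNReal_add (by positivity) h1]; simp)
  rw [Real.coe_toNNReal _ (by positivity), Real.coe_toNNReal _ h1, ← NNReal.rpow_mul,
    mul_one_div_cancel h0.ne', NNReal.rpow_one] at this
  exact this

/-- A discretised form of `∫ p x ^ (p - 1 + δ) ≤ x ^ δ * ∫ p x ^ (p - 1)`. -/
lemma rpow_add_le_weighted {p δ : ℝ} (hp : 0 < p) (hδ : 0 < δ) (x y : ℝ≥0) (hyx : y ≤ x) :
    (p / (p + δ)).toNNReal * x ^ (p + δ) ≤
      (p / (p + δ)).toNNReal * y ^ (p + δ) + x ^ δ * (x ^ p - y ^ p) := by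
  have hs : 0 < p + δ := by linarith
  have hsum : (p / (p + δ)).toNNReal + (δ / (p + δ)).toNNReal = 1 := by
    rw [← Real.toNNReal_add (by positivity) (by positivity), ← add_div, div_self hs.ne',
      Real.toNNReal_one]
  have := NNReal.geom_mean_le_arith_mean2_weighted (p / (p + δ)).toNNReal (δ / (p + δ)).toNNReal
    (y ^ (p + δ)) (x ^ (p + δ)) hsum
  rw [Real.coe_toNNReal _ (by positivity), Real.coe_toNNReal _ (by positivity),
    ← NNReal.rpow_mul, ← NNReal.rpow_mul, mul_div_cancel₀ _ hs.ne',
    mul_div_cancel₀ _ hs.ne'] at this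
  have hx : x ^ (p + δ) = x ^ δ * x ^ p := by
    rw [add_comm, NNReal.rpow_add_of_nonneg _ hδ.le hp.le]
  have hle : y ^ p ≤ x ^ p := NNReal.rpow_le_rpow hyx hp.le
  have key : x ^ (p + δ) + y ^ p * x ^ δ ≤
      (p / (p + δ)).toNNReal * y ^ (p + δ) + x ^ δ * (x ^ p - y ^ p) + y ^ p * x ^ δ +
        (δ / (p + δ)).toNNReal * x ^ (p + δ) := by
    calc x ^ (p + δ) + y ^ p * x ^ δ
        = x ^ δ * (x ^ p - y ^ p) + y ^ p * x ^ δ + y ^ p * x ^ δ := by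
          rw [hx]; nth_rw 1 [← tsub_add_cancel_of_le hle]; ring
      _ ≤ x ^ δ * (x ^ p - y ^ p) + y ^ p * x ^ δ + ((p / (p + δ)).toNNReal * y ^ (p + δ) +
        (δ / (p + δ)).toNNReal * x ^ (p + δ)) := by gcongr
      _ = _ := by ring
  have hx1 : x ^ (p + δ) = (p / (p + δ)).toNNReal * x ^ (p + δ)
      + (δ / (p + δ)).toNNReal * x ^ (p + δ) := by rw [← add_mul, hsum, one_mul]
  rw [← NNReal.coe_le_coe] at key ⊢
  have hx1' := congrArg NNReal.toReal hx1
  push_cast at key hx1' ⊢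
  linarith

/-- Bernoulli's inequality at `y / x - 1`, multiplied by `x ^ p`. -/
lemma rpow_sub_rpow_le {p : ℝ} (hp : 1 ≤ p) (x y : ℝ≥0) (hyx : y ≤ x) :
    x ^ p - y ^ p ≤ p.toNNReal * x ^ (p - 1) * (x - y) := by
  rcases eq_or_ne x 0 with rfl | hx
  · simp [NNReal.zero_rpow (by linarith : p ≠ 0)]
  have hx0 : (0 : ℝ) < x := by positivity
  have hb := one_add_mul_self_le_rpow_one_add (s := (y / x - 1 : ℝ))
    (by have : (0 : ℝ) ≤ y / x := by positivity
        linarith) hp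
  rw [add_sub_cancel, Real.div_rpow y.coe_nonneg x.coe_nonneg, le_div_iff₀ (by positivity)] at hb
  have hxp : (x : ℝ) ^ p = x ^ (p - 1) * x := by
    rw [← Real.rpow_add_one hx0.ne']; simp
  rw [tsub_le_iff_right, ← NNReal.coe_le_coe]
  push_cast [NNReal.coe_sub hyx]
  rw [Real.coe_toNNReal _ (by linarith)]
  have : (1 + p * (y / x - 1 : ℝ)) * (x : ℝ) ^ p =
      (x : ℝ) ^ p - p * x ^ (p - 1) * (x - y) := by
    rw [hxp]; field_simp; ring
  linarith

/-! ### Queue configurations, utilities and equilibria. -/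

/-- An assignment of the jobs to the queues of the machines; jobs in a queue are ordered by rank. -/
structure Config (m : ℕ) where
  mach : ℕ → Fin m
  rank : ℕ → ℕ

instance [NeZero m] : Nonempty (Config m) := ⟨⟨fun _ => 0, id⟩⟩

namespace Config

/-- The jobs of `A` in the queue of machine `i`. -/
def queue (Q : Config m) (A : Finset ℕ) (i : Fin m) : Finset ℕ := {l ∈ A | Q.mach l = i}

/-- The total weight in the queue of machine `i`. -/
noncomputable def load (Q : Config m) (w : ℕ → ℝ≥0) (A : Finset ℕ) (i : Fin m) : ℝ≥0 :=
  ∑ l ∈ Q.queue A i, w l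

/-- The weight of job `j` and of the jobs ahead of it in its queue. -/
noncomputable def front (Q : Config m) (w : ℕ → ℝ≥0) (A : Finset ℕ) (j : ℕ) : ℝ≥0 :=
  frontOf w (Q.queue A (Q.mach j)) Q.rank j

/-- The weight of the jobs ahead of job `j` in its queue. -/
noncomputable def before (Q : Config m) (w : ℕ → ℝ≥0) (A : Finset ℕ) (j : ℕ) : ℝ≥0 :=
  beforeOf w (Q.queue A (Q.mach j)) Q.rank j

/-- The utility of job `j`. -/
noncomputable def util (δ : ℝ) (Q : Config m) (w : ℕ → ℝ≥0) (e : Fin m → ℕ → ℝ≥0) (A : Finset ℕ)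
    (j : ℕ) : ℝ≥0 :=
  e (Q.mach j) j / Q.front w A j ^ δ

/-- No job gains by moving to the tail of a queue. -/
def Equil (δ : ℝ) (Q : Config m) (w : ℕ → ℝ≥0) (e : Fin m → ℕ → ℝ≥0) (A : Finset ℕ) : Prop :=
  Set.InjOn Q.rank A ∧ ∀ j ∈ A, ∀ i, e i j / (Q.load w A i + w j) ^ δ ≤ Q.util δ w e A j

variable {Q : Config m} {w w' : ℕ → ℝ≥0} {e e' : Fin m → ℕ → ℝ≥0} {A B : Finset ℕ} {j : ℕ} {δ : ℝ}

lemma mem_queue {i : Fin m} : j ∈ Q.queue A i ↔ j ∈ A ∧ Q.mach j = i := by simp [queue]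

lemma load_congr (hw : ∀ l ∈ A, w l = w' l) (i : Fin m) : Q.load w A i = Q.load w' A i :=
  Finset.sum_congr rfl fun l hl => hw l (mem_queue.1 hl).1

lemma front_congr (hw : ∀ l ∈ A, w l = w' l) (j : ℕ) : Q.front w A j = Q.front w' A j :=
  Finset.sum_congr rfl fun l hl => hw l (mem_queue.1 (Finset.mem_filter.1 hl).1).1

lemma before_congr (hw : ∀ l ∈ A, w l = w' l) (j : ℕ) : Q.before w A j = Q.before w' A j :=
  Finset.sum_congr rfl fun l hl => hw l (mem_queue.1 (Finset.mem_filter.1 hl).1).1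

lemma util_congr (hw : ∀ l ∈ A, w l = w' l) (he : ∀ i, e i j = e' i j) :
    Q.util δ w e A j = Q.util δ w' e' A j := by
  rw [util, util, front_congr hw, he]

lemma equil_congr (hw : ∀ l ∈ A, w l = w' l) (he : ∀ l ∈ A, ∀ i, e i l = e' i l) :
    Q.Equil δ w e A ↔ Q.Equil δ w' e' A := by
  refine and_congr Iff.rfl (forall₂_congr fun j hj => forall_congr' fun i => ?_)
  rw [util_congr hw (he j hj), load_congr hw, he j hj, hw j hj]

lemma front_le_load (Q : Config m) (w : ℕ → ℝ≥0) (A : Finset ℕ) (j : ℕ) :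
    Q.front w A j ≤ Q.load w A (Q.mach j) := frontOf_le_sum

lemma le_front (hj : j ∈ A) : w j ≤ Q.front w A j := le_frontOf (mem_queue.2 ⟨hj, rfl⟩)

lemma front_eq (hr : Set.InjOn Q.rank A) (hj : j ∈ A) :
    Q.front w A j = Q.before w A j + w j :=
  frontOf_eq (hr.mono fun _ h => (mem_queue.1 h).1) (mem_queue.2 ⟨hj, rfl⟩)

/-- A utility grows when the set of the jobs ahead shrinks. -/
lemma util_le_util {Q' : Config m} (hδ : 0 ≤ δ) (hj : j ∈ B) (hw : 0 < w j)
    (hm : Q'.mach j = Q.mach j)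
    (h : ∀ l ∈ B, Q'.mach l = Q.mach j → Q'.rank l ≤ Q'.rank j →
      l ∈ A ∧ Q.mach l = Q.mach j ∧ Q.rank l ≤ Q.rank j) :
    Q.util δ w e A j ≤ Q'.util δ w e B j := by
  have h1 : Q'.front w B j ≤ Q.front w A j := by
    refine Finset.sum_le_sum_of_subset fun l hl => ?_
    simp only [Finset.mem_filter, mem_queue, hm] at hl ⊢
    have := h l hl.1.1 hl.1.2 hl.2
    tauto
  have h0 : 0 < Q'.front w B j := hw.trans_le (le_front hj)
  rw [util, util, hm]
  have h2 : 0 < Q'.front w B j ^ δ := NNReal.rpow_pos h0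
  gcongr

/-- There are infinitely many configurations, since ranks are arbitrary naturals, but a utility
depends only on the machine and on the set of jobs ahead. Finiteness of the values allows the total
utility to be maximised. -/
lemma finite_range_util (δ : ℝ) (w : ℕ → ℝ≥0) (e : Fin m → ℕ → ℝ≥0) (A : Finset ℕ) :
    (Set.range fun Q : Config m => ∑ j ∈ A, Q.util δ w e A j).Finite := by
  let F : (A → Fin m × A.powerset) → ℝ≥0 := fun g =>
    ∑ j : A, e (g j).1 j / (∑ l ∈ ((g j).2 : Finset ℕ), w l) ^ δ
  refine (Set.finite_range F).subset ?_
  rintro _ ⟨Q, rfl⟩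
  refine ⟨fun j => (Q.mach j, ⟨{l ∈ Q.queue A (Q.mach j) | Q.rank l ≤ Q.rank j}, ?_⟩), ?_⟩
  · exact Finset.mem_powerset.2 ((Finset.filter_subset _ _).trans (Finset.filter_subset _ _))
  · exact Finset.sum_coe_sort A fun j => Q.util δ w e A j

/-- After the active set has changed from `B` to `A` there is an equilibrium in which no job that
stays is worse off. -/
theorem exists_equil (hδ : 0 ≤ δ) (w : ℕ → ℝ≥0) (e : Fin m → ℕ → ℝ≥0) (A B : Finset ℕ)
    (hA : ∀ j ∈ A, 0 < w j) (Q : Config m) (hQ : Set.InjOn Q.rank B) :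
    ∃ Q' : Config m, Q'.Equil δ w e A ∧ ∀ j ∈ A ∩ B, Q.util δ w e B j ≤ Q'.util δ w e A j := by
  let V : Set (Config m) :=
    {Q' | Set.InjOn Q'.rank A ∧ ∀ j ∈ A ∩ B, Q.util δ w e B j ≤ Q'.util δ w e A j}
  have hV : V.Nonempty := by
    -- Old jobs keep their places and new ones go behind all of them, so departures can only shorten
    -- the prefix of a surviving job.
    refine ⟨⟨Q.mach, fun j => if j ∈ B then Q.rank j else B.sup Q.rank + j + 1⟩, ?_, ?_⟩
    · have hle : ∀ l ∈ B, Q.rank l ≤ B.sup Q.rank := fun l hl => Finset.le_sup hl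
      intro x _ y _ hxy
      simp only at hxy
      split_ifs at hxy with h1 h2 h2
      · exact hQ h1 h2 hxy
      · have := hle x h1; omega
      · have := hle y h2; omega
      · omega
    · intro j hj
      rw [Finset.mem_inter] at hj
      refine util_le_util hδ hj.1 (hA j hj.1) rfl fun l _ h2 h3 => ?_
      have hle : Q.rank j ≤ B.sup Q.rank := Finset.le_sup hj.2
      simp only [hj.2, if_true] at h3
      split_ifs at h3 with h4
      · exact ⟨h4, h2, h3⟩
      · omega
  -- The total utility serves as potential. At a maximiser no move to a tail is profitable: it would
  -- raise the utility of the mover and lower no other, hence stay in `V`.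
  obtain ⟨Q', hQ', hmax⟩ : ∃ Q' ∈ V, ∀ Q'' ∈ V,
      ∑ j ∈ A, Q''.util δ w e A j ≤ ∑ j ∈ A, Q'.util δ w e A j := by
    obtain ⟨x, ⟨Q', hQ', rfl⟩, hx⟩ := Set.exists_max_image
      ((fun Q' : Config m => ∑ j ∈ A, Q'.util δ w e A j) '' V) id
      ((finite_range_util δ w e A).subset (Set.image_subset_range _ _)) (hV.image _)
    exact ⟨Q', hQ', fun Q'' h => hx _ ⟨Q'', h, rfl⟩⟩
  refine ⟨Q', ⟨hQ'.1, fun j hj i => ?_⟩, hQ'.2⟩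
  by_contra! hlt
  have hi : i ≠ Q'.mach j := by
    rintro rfl
    refine hlt.not_ge ?_
    have h1 : Q'.front w A j ≤ Q'.load w A (Q'.mach j) + w j :=
      (front_le_load _ _ _ _).trans (by simp)
    have h2 : 0 < Q'.front w A j ^ δ := NNReal.rpow_pos ((hA j hj).trans_le (le_front hj))
    rw [util]
    gcongr
  let Q'' : Config m :=
    ⟨Function.update Q'.mach j i, Function.update Q'.rank j (A.sup Q'.rank + 1)⟩
  have hrank : ∀ l ∈ A, Q'.rank l < A.sup Q'.rank + 1 := fun l hl =>
    Nat.lt_succ_of_le (Finset.le_sup hl)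
  have hinj : Set.InjOn Q''.rank A := by
    intro x hx y hy hxy
    by_cases h1 : x = j <;> by_cases h2 : y = j
    · rw [h1, h2]
    · subst h1
      simp only [Q'', Function.update_self, Function.update_of_ne h2] at hxy
      exact absurd hxy (hrank y hy).ne'
    · subst h2
      simp only [Q'', Function.update_self, Function.update_of_ne h1] at hxy
      exact absurd hxy (hrank x hx).ne
    · simp only [Q'', Function.update_of_ne h2, Function.update_of_ne h1] at hxy
      exact hQ'.1 hx hy hxy
  have hother : ∀ l ∈ A, l ≠ j → Q'.util δ w e A l ≤ Q''.util δ w e A l := by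
    intro l hl hlj
    refine util_le_util hδ hl (hA l hl) (by simp [Q'', hlj]) fun k hk h1 h2 => ?_
    by_cases hkj : k = j
    · subst hkj
      simp only [Q'', Function.update_self, Function.update_of_ne hlj] at h2
      exact absurd (hrank l hl) (by omega)
    · simp only [Q'', Function.update_of_ne hlj, Function.update_of_ne hkj] at h1 h2
      exact ⟨hk, h1, h2⟩
  have hself : Q'.util δ w e A j < Q''.util δ w e A j := by
    refine hlt.trans_le ?_
    have hf : Q''.front w A j ≤ Q'.load w A i + w j := by
      have hsub : (Q''.queue A (Q''.mach j)).filter (fun l => Q''.rank l ≤ Q''.rank j) ⊆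
          insert j (Q'.queue A i) := by
        intro l hl
        simp only [Finset.mem_filter, mem_queue] at hl
        rw [Finset.mem_insert, mem_queue]
        by_cases hlj : l = j
        · exact Or.inl hlj
        · refine Or.inr ⟨hl.1.1, ?_⟩
          simpa [Q'', Function.update_of_ne hlj] using hl.1.2
      refine (Finset.sum_le_sum_of_subset hsub).trans ?_
      rw [Finset.sum_insert (by simp [mem_queue, hi.symm]), add_comm, load]
    have h2 : 0 < Q''.front w A j ^ δ := NNReal.rpow_pos ((hA j hj).trans_le (le_front hj))
    have h3 : Q''.mach j = i := by simp [Q'']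
    rw [util, h3]
    gcongr
  have hmem : Q'' ∈ V := by
    refine ⟨hinj, fun l hl => ?_⟩
    by_cases hlj : l = j
    · subst hlj
      exact (hQ'.2 l hl).trans hself.le
    · exact (hQ'.2 l hl).trans (hother l (Finset.mem_inter.1 hl).1 hlj)
  refine (hmax Q'' hmem).not_gt (Finset.sum_lt_sum (fun l hl => ?_) ⟨j, hj, hself⟩)
  by_cases hlj : l = j
  · subst hlj
    exact hself.le
  · exact hother l hl hlj

/-- The state of the queues after the active set has run through a list of sets (the latest set
first). -/
noncomputable def ofHistory [NeZero m] (δ : ℝ) (w : ℕ → ℝ≥0) (e : Fin m → ℕ → ℝ≥0) :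
    List (Finset ℕ) → Config m
  | [] => ⟨fun _ => 0, id⟩
  -- The choice is a function of the weights, the rates and the history alone; this makes the
  -- algorithm non-anticipating.
  | A :: L => Classical.epsilon fun Q' => Q'.Equil δ w e A ∧
      ∀ j ∈ A ∩ L.headD ∅, (ofHistory δ w e L).util δ w e (L.headD ∅) j ≤ Q'.util δ w e A j

section

variable [NeZero m]

lemma headD_mem_or {L : List (Finset ℕ)} (hj : j ∈ L.headD ∅) : L.headD ∅ ∈ L := by
  cases L with
  | nil => simp at hj
  | cons A L => simp

lemma ofHistory_congr {L : List (Finset ℕ)} (hw : ∀ A ∈ L, ∀ l ∈ A, w l = w' l)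
    (he : ∀ A ∈ L, ∀ l ∈ A, ∀ i : Fin m, e i l = e' i l) :
    ofHistory δ w e L = ofHistory δ w' e' L := by
  induction L with
  | nil => rfl
  | cons A L ih =>
    have ih := ih (fun B hB => hw B (by simp [hB])) (fun B hB => he B (by simp [hB]))
    simp only [ofHistory, ih]
    congr 1
    funext Q'
    refine propext (and_congr (equil_congr (hw A (by simp)) (he A (by simp)))
      (forall₂_congr fun j hj => ?_))
    rw [Finset.mem_inter] at hj
    have hmem := List.mem_cons_of_mem A (headD_mem_or hj.2)
    rw [util_congr (hw A (by simp)) (he A (by simp) j hj.1),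
      util_congr (hw _ hmem) (he _ hmem j hj.2)]

lemma ofHistory_cons_spec (hδ : 0 ≤ δ) {L : List (Finset ℕ)}
    (hL : Set.InjOn (ofHistory δ w e L).rank (L.headD ∅)) (hA : ∀ j ∈ A, 0 < w j) :
    (ofHistory δ w e (A :: L)).Equil δ w e A ∧
      ∀ j ∈ A ∩ L.headD ∅, (ofHistory δ w e L).util δ w e (L.headD ∅) j ≤
        (ofHistory δ w e (A :: L)).util δ w e A j :=
  Classical.epsilon_spec (exists_equil hδ w e A (L.headD ∅) hA _ hL)

lemma equil_ofHistory (hδ : 0 ≤ δ) {L : List (Finset ℕ)} (hw : ∀ A ∈ L, ∀ j ∈ A, 0 < w j) :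
    (ofHistory δ w e L).Equil δ w e (L.headD ∅) := by
  induction L with
  | nil => exact ⟨by simp, by simp⟩
  | cons A L ih =>
    exact (ofHistory_cons_spec hδ (ih fun B hB => hw B (by simp [hB])).1 (hw A (by simp))).1

/-- Utilities of jobs that stay active never decrease. -/
lemma util_ofHistory_mono (hδ : 0 ≤ δ) {L₁ L : List (Finset ℕ)}
    (hw : ∀ A ∈ L₁ ++ L, ∀ j ∈ A, 0 < w j) (h₁ : ∀ A ∈ L₁, j ∈ A) (hj : j ∈ L.headD ∅) :
    (ofHistory δ w e L).util δ w e (L.headD ∅) j ≤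
      (ofHistory δ w e (L₁ ++ L)).util δ w e ((L₁ ++ L).headD ∅) j := by
  induction L₁ with
  | nil => exact le_rfl
  | cons A L₁ ih =>
    have hw' : ∀ A ∈ L₁ ++ L, ∀ j ∈ A, 0 < w j := fun B hB => hw B (List.mem_cons_of_mem _ hB)
    refine (ih hw' fun B hB => h₁ B (by simp [hB])).trans ?_
    refine (ofHistory_cons_spec hδ (equil_ofHistory hδ hw').1 (hw A (by simp))).2 j ?_
    rw [Finset.mem_inter]
    refine ⟨h₁ A (by simp), ?_⟩
    cases L₁ with
    | nil => exact hj
    | cons B L₁ => exact h₁ B (by simp)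

end

end Config

/-! ### Speeds and shares determined by a configuration. -/

namespace Config

/-- The speed of machine `i`: its power equals the weight in its queue. -/
noncomputable def speedOf (γ : ℝ) (Q : Config m) (w : ℕ → ℝ≥0) (A : Finset ℕ) (i : Fin m) : ℝ≥0 :=
  Q.load w A i ^ (1 / γ)

/-- The part of the speed of machine `i` that job `j` gets; jobs near the tail get more. -/
noncomputable def shareOf (γ : ℝ) (Q : Config m) (w : ℕ → ℝ≥0) (A : Finset ℕ) (i : Fin m) (j : ℕ) :
    ℝ≥0 :=
  if j ∈ A ∧ Q.mach j = i then
    Q.load w A i ^ (1 / γ) *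
      ((Q.front w A j ^ (2 * γ) - Q.before w A j ^ (2 * γ)) / Q.load w A i ^ (2 * γ))
  else 0

variable {Q : Config m} {w w' : ℕ → ℝ≥0} {A : Finset ℕ} {γ : ℝ}

lemma speedOf_congr (hw : ∀ l ∈ A, w l = w' l) (i : Fin m) :
    Q.speedOf γ w A i = Q.speedOf γ w' A i := by
  rw [speedOf, speedOf, load_congr hw]

lemma shareOf_congr (hw : ∀ l ∈ A, w l = w' l) (i : Fin m) (j : ℕ) :
    Q.shareOf γ w A i j = Q.shareOf γ w' A i j := by
  rw [shareOf, shareOf, load_congr hw, front_congr hw, before_congr hw]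

/-- The differences of `2γ`-th powers telescope to `W ^ (2γ)` along the queue, so the fractions sum
to at most one. -/
lemma sum_shareOf_le (hγ : 0 < γ) (hr : Set.InjOn Q.rank A) (J : Finset ℕ) (i : Fin m) :
    ∑ j ∈ J, Q.shareOf γ w A i j ≤ Q.speedOf γ w A i := by
  have h1 : ∑ j ∈ J, Q.shareOf γ w A i j ≤ ∑ j ∈ Q.queue A i, Q.shareOf γ w A i j := by
    refine Finset.sum_le_sum_of_ne_zero fun j _ hj => ?_
    rw [shareOf] at hj
    exact mem_queue.2 (by by_contra h; exact hj (if_neg h))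
  refine h1.trans ?_
  have h2 : ∀ j ∈ Q.queue A i, Q.shareOf γ w A i j = Q.load w A i ^ (1 / γ) *
      ((frontOf w (Q.queue A i) Q.rank j ^ (2 * γ) - beforeOf w (Q.queue A i) Q.rank j ^ (2 * γ)) /
        Q.load w A i ^ (2 * γ)) := by
    intro j hj
    have hj' := mem_queue.1 hj
    rw [shareOf, if_pos hj', front, before, hj'.2]
  rw [Finset.sum_congr rfl h2, ← Finset.mul_sum, ← Finset.sum_div, speedOf]
  refine mul_le_of_le_one_right zero_le (div_le_one_of_le₀ ?_ zero_le)
  have := sum_telescope_ge w (Q.queue A i) Q.rank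
    (hr.mono fun _ h => (mem_queue.1 h).1) (fun x => x ^ (2 * γ))
    (fun x y => x ^ (2 * γ) - y ^ (2 * γ))
    (fun x y h => (add_tsub_cancel_of_le (NNReal.rpow_le_rpow h (by positivity))).le)
  exact le_trans (by simp) this

lemma shareOf_le (hγ : 0 < γ) (hr : Set.InjOn Q.rank A) (i : Fin m) (j : ℕ) :
    Q.shareOf γ w A i j ≤ Q.speedOf γ w A i := by
  simpa using sum_shareOf_le (w := w) hγ hr {j} i

end Config

/-- The set of points of `E` passed by time `t` takes finitely many values, each on a finite
intersection of half-lines. Hence `G` may be arbitrary. -/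
lemma measurable_comp_filter_le {β : Type*} [MeasurableSpace β] (E : Finset ℝ)
    (G : Finset ℝ → β) : Measurable fun t : ℝ => G {x ∈ E | x ≤ t} := by
  intro s _
  have : (fun t : ℝ => G {x ∈ E | x ≤ t}) ⁻¹' s =
      ⋃ F ∈ {F : Finset ℝ | F ⊆ E ∧ G F ∈ s}, ⋂ x ∈ E, {t | x ≤ t ↔ x ∈ F} := by
    ext t
    simp only [Set.mem_preimage, Set.mem_ofPred_eq, Set.mem_iUnion, Set.mem_iInter, exists_prop]
    constructor
    · exact fun h => ⟨_, ⟨Finset.filter_subset _ _, h⟩, fun x hx => by simp [hx]⟩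
    · rintro ⟨F, ⟨h1, h2⟩, h3⟩
      convert h2
      ext x
      rw [Finset.mem_filter]
      exact ⟨fun h => (h3 x h.1).1 h.2, fun h => ⟨h1 h, (h3 x (h1 h)).2 h⟩⟩
  rw [this]
  refine Set.Finite.measurableSet_biUnion (E.powerset.finite_toSet.subset fun F hF => ?_)
    fun F _ => E.measurableSet_biInter fun x _ => ?_
  · simpa using hF.1
  · by_cases hx : x ∈ F
    · have h : {t : ℝ | x ≤ t ↔ x ∈ F} = Set.Ici x := by ext; simp [hx]
      exact h ▸ measurableSet_Ici
    · have h : {t : ℝ | x ≤ t ↔ x ∈ F} = Set.Iio x := by ext; simp [hx]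
      exact h ▸ measurableSet_Iio

/-! ### Active sets and event histories for prescribed completion times. -/

/-- The active jobs at time `u` when the jobs are completed at the times `c`. -/
noncomputable def act (I : JobInstance m) (c : ℕ → EReal) (u : ℝ) : Finset ℕ :=
  {j ∈ I.jobs | (I.release j : ℝ) ≤ u ∧ (u : EReal) < c j}

open Classical in
/-- All release and completion times. -/
noncomputable def allEvents (I : JobInstance m) (c : ℕ → EReal) : Finset ℝ :=
  I.jobs.image (fun j => (I.release j : ℝ)) ∪
    {j ∈ I.jobs | ∃ x : ℝ, (I.release j : ℝ) ≤ x ∧ c j = x}.image (fun j => (c j).toReal)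

/-- The release and completion times up to time `t`. -/
noncomputable def events (I : JobInstance m) (c : ℕ → EReal) (t : ℝ) : Finset ℝ :=
  {x ∈ allEvents I c | x ≤ t}

/-- The sets of active jobs that have occurred up to time `t`, the latest first. -/
noncomputable def hist (I : JobInstance m) (c : ℕ → EReal) (t : ℝ) : List (Finset ℕ) :=
  ((events I c t).sort (· ≥ ·)).map (act I c)

section History

variable {I I' : JobInstance m} {c c' : ℕ → EReal} {t t' x : ℝ} {j : ℕ}

lemma mem_act : j ∈ act I c t ↔ j ∈ I.jobs ∧ (I.release j : ℝ) ≤ t ∧ (t : EReal) < c j := by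
  simp [act]

lemma mem_events : x ∈ events I c t ↔
    x ≤ t ∧ ∃ j ∈ I.jobs, (I.release j : ℝ) = x ∨ ((I.release j : ℝ) ≤ x ∧ c j = x) := by
  classical
  simp only [events, allEvents, Finset.mem_filter, Finset.mem_union, Finset.mem_image]
  constructor
  · rintro ⟨⟨j, hj, rfl⟩ | ⟨j, ⟨hj, y, hy, hc⟩, rfl⟩, ht⟩
    · exact ⟨ht, j, hj, Or.inl rfl⟩
    · exact ⟨ht, j, hj, Or.inr (by simp [hc, hy])⟩
  · rintro ⟨ht, j, hj, h | ⟨h1, h2⟩⟩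
    · exact ⟨Or.inl ⟨j, hj, h⟩, ht⟩
    · exact ⟨Or.inr ⟨j, ⟨hj, x, h1, h2⟩, by simp [h2]⟩, ht⟩

lemma mem_hist {A : Finset ℕ} : A ∈ hist I c t ↔ ∃ x ∈ events I c t, act I c x = A := by
  simp [hist]

/-- The active set changes only at events, so its value at the latest event is still current. With
no event so far nothing has been released, and the default `∅` is right. -/
lemma headD_hist (I : JobInstance m) (c : ℕ → EReal) (t : ℝ) :
    (hist I c t).headD ∅ = act I c t := by
  have hrel : ∀ j ∈ act I c t, (I.release j : ℝ) ∈ events I c t := fun j hj => by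
    rw [mem_act] at hj
    exact mem_events.2 ⟨hj.2.1, j, hj.1, Or.inl rfl⟩
  have hsort := Finset.pairwise_sort (events I c t) (· ≥ ·)
  have hmem : ∀ y, y ∈ (events I c t).sort (· ≥ ·) ↔ y ∈ events I c t := fun y => by simp
  rw [hist]
  cases h : (events I c t).sort (· ≥ ·) with
  | nil =>
    rw [h] at hmem
    symm
    simp only [List.map_nil, List.headD_nil]
    refine Finset.eq_empty_of_forall_notMem fun j hj => ?_
    have := (hmem _).2 (hrel j hj)
    simp at this
  | cons y l =>
    rw [h] at hmem hsort
    simp only [List.map_cons, List.headD_cons]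
    have hy := mem_events.1 ((hmem y).1 (by simp))
    have hmax : ∀ z ∈ events I c t, z ≤ y := fun z hz => by
      rcases List.mem_cons.1 ((hmem z).2 hz) with rfl | hz
      · exact le_rfl
      · exact List.rel_of_pairwise_cons hsort hz
    ext j
    constructor
    · intro hj
      rw [mem_act] at hj ⊢
      refine ⟨hj.1, hj.2.1.trans hy.1, ?_⟩
      by_contra! hle
      have hbot : c j ≠ ⊥ := (bot_le.trans_lt hj.2.2).ne'
      have htop : c j ≠ ⊤ := (hle.trans_lt (EReal.coe_lt_top t)).ne
      have hc : c j = ((c j).toReal : ℝ) := (EReal.coe_toReal htop hbot).symm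
      have h1 : y < (c j).toReal := by
        rw [← EReal.coe_lt_coe_iff, ← hc]; exact hj.2.2
      have h2 : (c j).toReal ≤ t := by
        rw [← EReal.coe_le_coe_iff, ← hc]; exact hle
      exact h1.not_ge (hmax _ (mem_events.2
        ⟨h2, j, hj.1, Or.inr ⟨hj.2.1.trans h1.le, hc⟩⟩))
    · intro hj
      have h1 := hmax _ (hrel j hj)
      rw [mem_act] at hj ⊢
      exact ⟨hj.1, h1, lt_of_le_of_lt (EReal.coe_le_coe_iff.2 hy.1) hj.2.2⟩

lemma hist_append (I : JobInstance m) (c : ℕ → EReal) (h : t ≤ t') :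
    ∃ L, hist I c t' = L ++ hist I c t ∧ ∀ A ∈ L, ∃ x, t ≤ x ∧ x ≤ t' ∧ A = act I c x := by
  classical
  have hsub : events I c t ⊆ events I c t' := fun x hx => by
    rw [mem_events] at hx ⊢
    exact ⟨hx.1.trans h, hx.2⟩
  have hE : (events I c t').sort (· ≥ ·) =
      (events I c t' \ events I c t).sort (· ≥ ·) ++ (events I c t).sort (· ≥ ·) := by
    refine List.Perm.eq_of_pairwise (le := (· ≥ ·)) (fun a b _ _ h1 h2 => le_antisymm h2 h1)
      (Finset.pairwise_sort _ _) ?_ ?_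
    · refine List.pairwise_append.2 ⟨Finset.pairwise_sort _ _, Finset.pairwise_sort _ _, ?_⟩
      intro a ha b hb
      simp only [Finset.mem_sort, Finset.mem_sdiff, mem_events] at ha hb
      by_contra hab
      exact ha.2 ⟨(not_le.1 hab).le.trans hb.1, ha.1.2⟩
    · refine (List.perm_ext_iff_of_nodup (Finset.sort_nodup _ _) ?_).2 fun a => ?_
      · refine List.nodup_append.2 ⟨Finset.sort_nodup _ _, Finset.sort_nodup _ _, ?_⟩
        intro a ha b hb hab
        simp only [Finset.mem_sort, Finset.mem_sdiff] at ha hb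
        exact ha.2 (hab ▸ hb)
      · simp only [Finset.mem_sort, List.mem_append, Finset.mem_sdiff]
        by_cases ha : a ∈ events I c t
        · simp [ha, hsub ha]
        · simp [ha]
  refine ⟨((events I c t' \ events I c t).sort (· ≥ ·)).map (act I c), ?_, ?_⟩
  · rw [hist, hE, List.map_append, hist]
  · intro A hA
    obtain ⟨x, hx, rfl⟩ := List.mem_map.1 hA
    simp only [Finset.mem_sort, Finset.mem_sdiff, mem_events] at hx
    refine ⟨x, ?_, hx.1.1, rfl⟩
    by_contra hlt
    exact hx.2 ⟨(not_le.1 hlt).le, hx.1.2⟩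

/-- The same can be seen up to time `t` if the jobs of `I` are completed at the times `c` and those
of `I'` at the times `c'`. -/
structure Agree (I : JobInstance m) (c : ℕ → EReal) (I' : JobInstance m) (c' : ℕ → EReal)
    (t : ℝ) : Prop where
  released_iff : ∀ j, (j ∈ I.jobs ∧ (I.release j : ℝ) ≤ t) ↔
    (j ∈ I'.jobs ∧ (I'.release j : ℝ) ≤ t)
  release_eq : ∀ j ∈ I.jobs, (I.release j : ℝ) ≤ t → I.release j = I'.release j
  weight_eq : ∀ j ∈ I.jobs, (I.release j : ℝ) ≤ t → I.weight j = I'.weight j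
  eff_eq : ∀ j ∈ I.jobs, (I.release j : ℝ) ≤ t → ∀ i, I.eff i j = I'.eff i j
  completed_iff : ∀ j ∈ I.jobs, (I.release j : ℝ) ≤ t → ∀ u : ℝ, u ≤ t → (c j ≤ u ↔ c' j ≤ u)

lemma Agree.symm (h : Agree I c I' c' t) : Agree I' c' I c t where
  released_iff j := (h.released_iff j).symm
  release_eq j hj hr :=
    have h' := (h.released_iff j).2 ⟨hj, hr⟩
    (h.release_eq j h'.1 h'.2).symm
  weight_eq j hj hr :=
    have h' := (h.released_iff j).2 ⟨hj, hr⟩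
    (h.weight_eq j h'.1 h'.2).symm
  eff_eq j hj hr i :=
    have h' := (h.released_iff j).2 ⟨hj, hr⟩
    (h.eff_eq j h'.1 h'.2 i).symm
  completed_iff j hj hr u hu :=
    have h' := (h.released_iff j).2 ⟨hj, hr⟩
    (h.completed_iff j h'.1 h'.2 u hu).symm

lemma Agree.mem_act (h : Agree I c I' c' t) (hx : x ≤ t) (hj : j ∈ act I c x) :
    j ∈ act I' c' x := by
  rw [FlowEnergy.mem_act] at hj ⊢
  have h1 := (h.released_iff j).1 ⟨hj.1, hj.2.1.trans hx⟩
  have h2 := h.release_eq j hj.1 (hj.2.1.trans hx)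
  have h3 := h.completed_iff j hj.1 (hj.2.1.trans hx) x hx
  exact ⟨h1.1, h2 ▸ hj.2.1, not_le.1 fun h => hj.2.2.not_ge (h3.2 h)⟩

lemma Agree.act_eq (h : Agree I c I' c' t) (hx : x ≤ t) : act I c x = act I' c' x := by
  ext j
  exact ⟨h.mem_act hx, h.symm.mem_act hx⟩

lemma Agree.mem_events (h : Agree I c I' c' t) (hx : x ∈ events I c t) : x ∈ events I' c' t := by
  rw [FlowEnergy.mem_events] at hx ⊢
  obtain ⟨hxt, j, hj, hor⟩ := hx
  have hr : (I.release j : ℝ) ≤ x := hor.elim (fun h => h.le) fun h => h.1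
  have h1 := (h.released_iff j).1 ⟨hj, hr.trans hxt⟩
  have h2 := h.release_eq j hj (hr.trans hxt)
  refine ⟨hxt, j, h1.1, hor.imp (fun h => h2 ▸ h) fun hc => ⟨h2 ▸ hr, ?_⟩⟩
  have h3 := h.completed_iff j hj (hr.trans hxt)
  -- Only comparisons with times up to `t` are shared. A smaller `c' j` would be separated from `x`
  -- by a real `u`, where the two instances would disagree.
  refine le_antisymm ((h3 x hxt).1 hc.2.le) ?_
  by_contra! hlt
  obtain ⟨u, hu1, hu2⟩ := EReal.lt_iff_exists_real_btwn.1 hlt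
  have hux : u < x := EReal.coe_lt_coe_iff.1 hu2
  have := (h3 u (hux.le.trans hxt)).2 hu1.le
  rw [hc.2] at this
  exact hu2.not_ge this

lemma Agree.hist_eq (h : Agree I c I' c' t) : hist I c t = hist I' c' t := by
  have hE : events I c t = events I' c' t := by
    ext x
    exact ⟨h.mem_events, h.symm.mem_events⟩
  rw [hist, hist, hE]
  refine List.map_congr_left fun x hx => h.act_eq ?_
  rw [Finset.mem_sort, FlowEnergy.mem_events] at hx
  exact hx.1

lemma Agree.weight_eq_of_mem_act (h : Agree I c I' c' t) :
    ∀ l ∈ act I c t, I.weight l = I'.weight l := by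
  intro l hl
  rw [FlowEnergy.mem_act] at hl
  exact h.weight_eq l hl.1 hl.2.1

lemma weight_pos_of_mem_hist {A : Finset ℕ} (hA : A ∈ hist I c t) : ∀ j ∈ A, 0 < I.weight j := by
  obtain ⟨x, hx, rfl⟩ := mem_hist.1 hA
  intro j hj
  exact I.weight_pos j (mem_act.1 hj).1

lemma one_sub_inv_nonneg {γ : ℝ} (hγ : 1 < γ) : 0 ≤ 1 - 1 / γ := by
  rw [sub_nonneg, div_le_one (by linarith)]
  exact hγ.le

variable [NeZero m] {γ : ℝ}

/-- The state of the queues at time `t`. -/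
noncomputable def state (γ : ℝ) (I : JobInstance m) (c : ℕ → EReal) (t : ℝ) : Config m :=
  Config.ofHistory (1 - 1 / γ) I.weight I.eff (hist I c t)

/-- The schedule obtained from the queues when the jobs are completed at the times `c`. -/
noncomputable def sched (γ : ℝ) (I : JobInstance m) (c : ℕ → EReal) : Schedule m where
  speed i t := (state γ I c t).speedOf γ I.weight (act I c t) i
  share i j t := (state γ I c t).shareOf γ I.weight (act I c t) i j

lemma Agree.state_eq (h : Agree I c I' c' t) : state γ I c t = state γ I' c' t := by
  have hmem : ∀ A ∈ hist I c t, ∀ l ∈ A, l ∈ I.jobs ∧ (I.release l : ℝ) ≤ t := by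
    intro A hA l hl
    obtain ⟨x, hx, rfl⟩ := mem_hist.1 hA
    rw [FlowEnergy.mem_act] at hl
    exact ⟨hl.1, hl.2.1.trans (FlowEnergy.mem_events.1 hx).1⟩
  rw [state, state, ← h.hist_eq]
  exact Config.ofHistory_congr
    (fun A hA l hl => h.weight_eq l (hmem A hA l hl).1 (hmem A hA l hl).2)
    (fun A hA l hl i => h.eff_eq l (hmem A hA l hl).1 (hmem A hA l hl).2 i)

lemma Agree.speed_eq (h : Agree I c I' c' t) (i : Fin m) :
    (sched γ I c).speed i t = (sched γ I' c').speed i t := by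
  simp only [sched]
  rw [← h.act_eq le_rfl, ← h.state_eq, Config.speedOf_congr h.weight_eq_of_mem_act]

lemma Agree.share_eq (h : Agree I c I' c' t) (i : Fin m) (j : ℕ) :
    (sched γ I c).share i j t = (sched γ I' c').share i j t := by
  simp only [sched]
  rw [← h.act_eq le_rfl, ← h.state_eq, Config.shareOf_congr h.weight_eq_of_mem_act]

lemma equil_state (hγ : 1 < γ) (I : JobInstance m) (c : ℕ → EReal) (t : ℝ) :
    (state γ I c t).Equil (1 - 1 / γ) I.weight I.eff (act I c t) := by
  rw [← headD_hist]
  exact Config.equil_ofHistory (one_sub_inv_nonneg hγ) fun A hA => weight_pos_of_mem_hist hA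

/-- A job active at both times is active at every event in between, so the monotonicity of single
rearrangements can be chained. -/
lemma util_state_mono (hγ : 1 < γ) (h : t ≤ t') (hj : j ∈ act I c t) (hj' : j ∈ act I c t') :
    (state γ I c t).util (1 - 1 / γ) I.weight I.eff (act I c t) j ≤
      (state γ I c t').util (1 - 1 / γ) I.weight I.eff (act I c t') j := by
  obtain ⟨L, hL, hmem⟩ := hist_append I c h
  have hw : ∀ A ∈ L ++ hist I c t, ∀ j ∈ A, 0 < I.weight j := fun A hA =>
    weight_pos_of_mem_hist (hL ▸ hA)
  rw [← headD_hist I c t', ← headD_hist I c t, state, state, hL]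
  refine Config.util_ofHistory_mono (one_sub_inv_nonneg hγ) hw (fun A hA => ?_) ?_
  · obtain ⟨x, h1, h2, rfl⟩ := hmem A hA
    rw [mem_act] at hj hj' ⊢
    exact ⟨hj.1, hj.2.1.trans h1, lt_of_le_of_lt (EReal.coe_le_coe_iff.2 h2) hj'.2.2⟩
  · rwa [headD_hist]

lemma measurable_speed_sched (γ : ℝ) (I : JobInstance m) (c : ℕ → EReal) (i : Fin m) :
    Measurable ((sched γ I c).speed i) := by
  have := measurable_comp_filter_le (allEvents I c) fun E =>
    let L := (E.sort (· ≥ ·)).map (act I c)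
    (Config.ofHistory (1 - 1 / γ) I.weight I.eff L).speedOf γ I.weight (L.headD ∅) i
  convert this using 2 with t
  simp only [sched, ← headD_hist I c t]
  rfl

lemma measurable_share_sched (γ : ℝ) (I : JobInstance m) (c : ℕ → EReal) (i : Fin m) (j : ℕ) :
    Measurable ((sched γ I c).share i j) := by
  have := measurable_comp_filter_le (allEvents I c) fun E =>
    let L := (E.sort (· ≥ ·)).map (act I c)
    (Config.ofHistory (1 - 1 / γ) I.weight I.eff L).shareOf γ I.weight (L.headD ∅) i j
  convert this using 2 with t
  simp only [sched, ← headD_hist I c t]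
  rfl

lemma speed_sched_le (hγ : 1 < γ) (I : JobInstance m) (c : ℕ → EReal) (i : Fin m) (t : ℝ) :
    (sched γ I c).speed i t ≤ (∑ j ∈ I.jobs, I.weight j) ^ (1 / γ) := by
  refine NNReal.rpow_le_rpow (Finset.sum_le_sum_of_subset fun l hl => ?_) (by positivity)
  exact (mem_act.1 (Config.mem_queue.1 hl).1).1

lemma share_sched_le (hγ : 1 < γ) (I : JobInstance m) (c : ℕ → EReal) (i : Fin m) (j : ℕ) (t : ℝ) :
    (sched γ I c).share i j t ≤ (∑ j ∈ I.jobs, I.weight j) ^ (1 / γ) :=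
  (Config.shareOf_le (by linarith) (equil_state hγ I c t).1 i j).trans (speed_sched_le hγ I c i t)

end History

/-! ### Work and completion times. -/

/-- The rate at which job `j` is processed at time `u`. -/
noncomputable def rate (I : JobInstance m) (S : Schedule m) (j : ℕ) (u : ℝ) : ℝ≥0 :=
  ∑ i : Fin m, I.eff i j * S.share i j u

/-- The time at which job `j` is completed. -/
noncomputable def completionTime (I : JobInstance m) (S : Schedule m) (j : ℕ) : EReal :=
  sInf ((fun t : ℝ => (t : EReal)) '' {t : ℝ | CompletedBy I S j t})

section Work

variable {I : JobInstance m} {S S' : Schedule m} {j : ℕ} {t t' u : ℝ} {K : ℝ≥0}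

lemma measurable_rate (hS : ∀ i, Measurable (S.share i j)) : Measurable (rate I S j) :=
  Finset.measurable_fun_sum _ fun i _ => (hS i).const_mul _

lemma work_eq_lintegral (hS : ∀ i, Measurable (S.share i j)) (t : ℝ) :
    work I S j t = ∫⁻ u in Set.Icc (I.release j : ℝ) t, (rate I S j u : ℝ≥0∞) := by
  rw [work, ← lintegral_finsetSum]
  · simp [rate]
  · exact fun i _ => ((hS i).const_mul _).coe_nnreal_ennreal

lemma work_mono (h : t ≤ t') : work I S j t ≤ work I S j t' :=
  Finset.sum_le_sum fun _ _ => lintegral_mono_set (Set.Icc_subset_Icc_right h)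

lemma CompletedBy.mono (hc : CompletedBy I S j t) (h : t ≤ t') : CompletedBy I S j t' :=
  ⟨hc.1.trans h, hc.2.trans (work_mono h)⟩

lemma work_le_add (hS : ∀ i, Measurable (S.share i j)) (hK : ∀ u, rate I S j u ≤ K)
    : work I S j t' ≤ work I S j t + K * ENNReal.ofReal (t' - t) := by
  rw [work_eq_lintegral hS, work_eq_lintegral hS]
  have hsub : Set.Icc (I.release j : ℝ) t' ⊆ Set.Icc (I.release j : ℝ) t ∪ Set.Ioc t t' := by
    intro x hx
    rcases le_or_gt x t with h1 | h1
    · exact Or.inl ⟨hx.1, h1⟩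
    · exact Or.inr ⟨h1, hx.2⟩
  refine (lintegral_mono_set hsub).trans ((lintegral_union_le _ _ _).trans ?_)
  gcongr
  calc ∫⁻ u in Set.Ioc t t', (rate I S j u : ℝ≥0∞) ≤ ∫⁻ _ in Set.Ioc t t', (K : ℝ≥0∞) :=
        lintegral_mono fun u => ENNReal.coe_le_coe.2 (hK u)
    _ = K * ENNReal.ofReal (t' - t) := by simp

lemma mul_ofReal_div_le {K ε : ℝ≥0} : (K : ℝ≥0∞) * ENNReal.ofReal (ε / (K + 1) : ℝ) ≤ ε := by
  have : (ε / (K + 1) : ℝ) = ((ε / (K + 1) : ℝ≥0) : ℝ) := by push_cast; rfl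
  rw [this, ENNReal.ofReal_coe_nnreal, ← ENNReal.coe_mul, ENNReal.coe_le_coe, mul_div_left_comm]
  exact mul_le_of_le_one_right zero_le (div_le_one_of_le₀ (by simp) zero_le)

/-- A bounded rate makes the work Lipschitz in time, so the infimum defining the completion time is
attained. -/
lemma completionTime_le_iff (hS : ∀ i, Measurable (S.share i j)) (hK : ∀ u, rate I S j u ≤ K) :
    completionTime I S j ≤ t ↔ CompletedBy I S j t := by
  refine ⟨fun h => ?_, fun h => sInf_le ⟨t, h, rfl⟩⟩
  have hgt : ∀ u : ℝ, t < u → CompletedBy I S j u := by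
    intro u hu
    obtain ⟨_, ⟨s, hs, rfl⟩, hsu⟩ := sInf_lt_iff.1 (h.trans_lt (EReal.coe_lt_coe_iff.2 hu))
    exact CompletedBy.mono hs (EReal.coe_lt_coe_iff.1 hsu).le
  refine ⟨le_of_forall_gt_imp_ge_of_dense fun u hu => (hgt u hu).1, ?_⟩
  refine ENNReal.le_of_forall_pos_le_add fun ε hε _ => ?_
  have hpos : (0 : ℝ) < ε / (K + 1) := by positivity
  have := (hgt (t + ε / (K + 1)) (by linarith)).2
  refine this.trans ((work_le_add (t := t) hS hK).trans ?_)
  gcongr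
  rw [add_sub_cancel_left]
  exact mul_ofReal_div_le

/-- The endpoint is a null set. The strict inequality `u < t` lets a completion at `t` be decided by
the schedule strictly before `t`. -/
lemma work_congr_of_lt (h : ∀ u < t, ∀ i, S.share i j u = S'.share i j u) :
    work I S j t = work I S' j t := by
  refine Finset.sum_congr rfl fun i _ => ?_
  rw [← setLIntegral_congr Ico_ae_eq_Icc, ← setLIntegral_congr Ico_ae_eq_Icc]
  exact setLIntegral_congr_fun measurableSet_Ico fun u hu => by simp only [h u hu.2 i]

lemma not_completedBy_of_le_release (hp : 0 < I.size j) (ht : t ≤ I.release j) :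
    ¬ CompletedBy I S j t := by
  rintro ⟨h1, h2⟩
  obtain rfl : t = I.release j := le_antisymm ht h1
  have : work I S j (I.release j) = 0 := by simp [work]
  rw [this] at h2
  simp [hp.ne'] at h2

lemma release_lt_completionTime (hS : ∀ i, Measurable (S.share i j))
    (hK : ∀ u, rate I S j u ≤ K) (hp : 0 < I.size j) :
    ((I.release j : ℝ) : EReal) < completionTime I S j := by
  rw [← not_le, completionTime_le_iff hS hK]
  exact not_completedBy_of_le_release hp le_rfl

/-- A job is not processed beyond its size. -/
lemma work_le_size (hS : ∀ i, Measurable (S.share i j)) (hK : ∀ u, rate I S j u ≤ K)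
    (hz : ∀ u, CompletedBy I S j u → rate I S j u = 0) (ht : I.release j ≤ t) :
    work I S j t ≤ I.size j := by
  by_cases hc : CompletedBy I S j t
  swap
  · have : ¬ (I.size j : ℝ≥0∞) ≤ work I S j t := fun h => hc ⟨ht, h⟩
    exact (not_le.1 this).le
  have htop : completionTime I S j ≠ ⊤ :=
    (((completionTime_le_iff hS hK).2 hc).trans_lt (EReal.coe_lt_top t)).ne
  have hbot : completionTime I S j ≠ ⊥ := by
    refine (lt_of_lt_of_le (EReal.bot_lt_coe (I.release j : ℝ)) (le_sInf ?_)).ne'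
    rintro _ ⟨u, hu, rfl⟩
    exact EReal.coe_le_coe_iff.2 hu.1
  obtain ⟨x, hx⟩ : ∃ x : ℝ, completionTime I S j = x :=
    ⟨_, (EReal.coe_toReal htop hbot).symm⟩
  have hiff : ∀ u : ℝ, CompletedBy I S j u ↔ x ≤ u := fun u => by
    rw [← completionTime_le_iff hS hK, hx, EReal.coe_le_coe_iff]
  have hxt : x ≤ t := (hiff t).1 hc
  have h1 : work I S j t = work I S j x := by
    rw [work_eq_lintegral hS, work_eq_lintegral hS]
    refine le_antisymm ?_ (lintegral_mono_set (Set.Icc_subset_Icc_right hxt))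
    have hsub : Set.Icc (I.release j : ℝ) t ⊆ Set.Icc (I.release j : ℝ) x ∪ Set.Ioc x t := by
      intro y hy
      rcases le_or_gt y x with h1 | h1
      · exact Or.inl ⟨hy.1, h1⟩
      · exact Or.inr ⟨h1, hy.2⟩
    refine (lintegral_mono_set hsub).trans ((lintegral_union_le _ _ _).trans ?_)
    have : ∫⁻ u in Set.Ioc x t, (rate I S j u : ℝ≥0∞) = 0 := by
      rw [setLIntegral_congr_fun (g := fun _ => 0) measurableSet_Ioc fun u hu => by
        simp [hz u ((hiff u).2 hu.1.le)]]
      simp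
    rw [this, add_zero]
  rw [h1]
  refine ENNReal.le_of_forall_pos_le_add fun ε hε _ => ?_
  -- Just before completion the work is at most the size, and at rate at most `K` it grows by at
  -- most `ε` over the last `ε / (K + 1)` units of time.
  have hpos : (0 : ℝ) < ε / (K + 1) := by positivity
  refine (work_le_add (t := x - ε / (K + 1)) hS hK).trans ?_
  rw [sub_sub_cancel]
  refine add_le_add ?_ mul_ofReal_div_le
  have hnc : ¬ CompletedBy I S j (x - ε / (K + 1)) := by rw [hiff]; linarith
  by_cases hr : (I.release j : ℝ) ≤ x - ε / (K + 1)
  · have : ¬ (I.size j : ℝ≥0∞) ≤ work I S j (x - ε / (K + 1)) := fun h => hnc ⟨hr, h⟩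
    exact (not_le.1 this).le
  · have : work I S j (x - ε / (K + 1)) = 0 := by
      rw [work, Set.Icc_eq_empty hr]
      simp
    simp [this]

end Work

/-! ### Self-consistent completion times and the algorithm. -/

section Fixpoint

variable [NeZero m] {γ : ℝ}

lemma exists_rate_sched_le (hγ : 1 < γ) (I : JobInstance m) (j : ℕ) :
    ∃ K : ℝ≥0, ∀ c u, rate I (sched γ I c) j u ≤ K :=
  ⟨∑ i, I.eff i j * (∑ j ∈ I.jobs, I.weight j) ^ (1 / γ), fun c u =>
    Finset.sum_le_sum fun i _ => by
      have := share_sched_le hγ I c i j u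
      gcongr⟩

lemma completionTime_sched_le_iff (hγ : 1 < γ) {I : JobInstance m} {c : ℕ → EReal} {j : ℕ}
    {t : ℝ} : completionTime I (sched γ I c) j ≤ t ↔ CompletedBy I (sched γ I c) j t :=
  have ⟨_, hK⟩ := exists_rate_sched_le hγ I j
  completionTime_le_iff (fun i => measurable_share_sched γ I c i j) (hK c)

/-- The completion times `c` are consistent up to time `T`. -/
def ConsistentUpTo (γ : ℝ) (I : JobInstance m) (c : ℕ → EReal) (T : ℝ) : Prop :=
  ∀ j ∈ I.jobs, (c j ≤ T ∧ c j = completionTime I (sched γ I c) j) ∨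
    (c j = ⊤ ∧ (T : EReal) < completionTime I (sched γ I c) j)

/-- Knowing the events before `τ` fixes the shares before `τ`, and hence which jobs are finished at
`τ`; this breaks the circularity. -/
lemma completionTime_congr (hγ : 1 < γ) {I : JobInstance m} {c c' : ℕ → EReal} {τ : ℝ}
    (h : ∀ t < τ, Agree I c I c' t) {j : ℕ} {x : ℝ} (hx : x ≤ τ) :
    completionTime I (sched γ I c) j ≤ x ↔ completionTime I (sched γ I c') j ≤ x := by
  rw [completionTime_sched_le_iff hγ, completionTime_sched_le_iff hγ, CompletedBy, CompletedBy,
    work_congr_of_lt fun u hu i => (h u (hu.trans_le hx)).share_eq i j]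

/-- Consistent completion times are extended by the next completion. -/
lemma exists_completionTimes_aux (hγ : 1 < γ) (I : JobInstance m) (n : ℕ) :
    ∀ (c : ℕ → EReal) (T : ℝ), ConsistentUpTo γ I c T →
      ({j ∈ I.jobs | c j = ⊤} : Finset ℕ).card ≤ n →
      ∃ c : ℕ → EReal, ∀ j ∈ I.jobs, c j = completionTime I (sched γ I c) j := by
  induction n with
  | zero =>
    intro c T hc hn
    refine ⟨c, fun j hj => ?_⟩
    rcases hc j hj with h | h
    · exact h.2
    · have : j ∈ ({j ∈ I.jobs | c j = ⊤} : Finset ℕ) := by simp [hj, h.1]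
      rw [Nat.le_zero, Finset.card_eq_zero] at hn
      simp [hn] at this
  | succ n ih =>
    intro c T hc hn
    set F := fun j => completionTime I (sched γ I c) j with hF
    by_cases hall : ∀ j ∈ I.jobs, c j = F j
    · exact ⟨c, hall⟩
    push Not at hall
    obtain ⟨j₀, hj₀, hne⟩ := hall
    have hM : ({j ∈ I.jobs | c j = ⊤} : Finset ℕ).Nonempty := by
      rcases hc j₀ hj₀ with h | h
      · exact absurd h.2 hne
      · exact ⟨j₀, by simp [hj₀, h.1]⟩
    obtain ⟨k, hk, hmin⟩ := Finset.exists_min_image _ F hM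
    simp only [Finset.mem_filter] at hk hmin
    have hTk : (T : EReal) < F k := by
      rcases hc k hk.1 with h | h
      · exact absurd (hk.2 ▸ h.1) (by simp)
      · exact h.2
    -- If even the earliest pending completion were `⊤`, all pending jobs would already be
    -- consistent, contrary to the choice of `j₀`.
    have hktop : F k ≠ ⊤ := by
      intro h
      rcases hc j₀ hj₀ with h' | h'
      · exact hne h'.2
      · exact hne (h'.1.trans (top_le_iff.1 (h ▸ hmin j₀ ⟨hj₀, h'.1⟩)).symm)
    obtain ⟨τ, hτ⟩ : ∃ τ : ℝ, F k = τ :=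
      ⟨_, (EReal.coe_toReal hktop (bot_le.trans_lt hTk).ne').symm⟩
    rw [hτ] at hTk hmin
    classical
    -- All pending jobs that finish at `τ` are fixed together, so that those left pending finish
    -- strictly after `τ`.
    let c' : ℕ → EReal := fun j => if c j = ⊤ ∧ F j = τ then (τ : EReal) else c j
    have hagree : ∀ t < τ, Agree I c I c' t := fun t ht =>
      { released_iff := fun _ => Iff.rfl
        release_eq := fun _ _ _ => rfl
        weight_eq := fun _ _ _ => rfl
        eff_eq := fun _ _ _ _ => rfl
        completed_iff := fun j _ _ u hu => by
          by_cases h : c j = ⊤ ∧ F j = τ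
          · have h1 : ¬ τ ≤ u := by linarith
            simp [c', h, h1]
          · simp only [c', if_neg h] }
    have hlt : ∀ j, ∀ x : ℝ, x ≤ τ → (F j ≤ x ↔ completionTime I (sched γ I c') j ≤ x) :=
      fun j x hx => completionTime_congr hγ hagree hx
    have hgt : ∀ j, (τ : EReal) < F j → (τ : EReal) < completionTime I (sched γ I c') j := by
      intro j h
      rw [← not_le] at h ⊢
      rwa [← hlt j τ le_rfl]
    have heq : ∀ j, ∀ x : ℝ, x ≤ τ → F j = x → completionTime I (sched γ I c') j = x := by
      intro j x hx h
      refine le_antisymm ((hlt j x hx).1 h.le) ?_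
      by_contra! hl
      obtain ⟨u, hu1, hu2⟩ := EReal.lt_iff_exists_real_btwn.1 hl
      have := (hlt j u ((EReal.coe_lt_coe_iff.1 hu2).le.trans hx)).2 hu1.le
      exact (h ▸ hu2).not_ge this
    refine ih c' τ (fun j hj => ?_) ?_
    · by_cases h : c j = ⊤ ∧ F j = τ
      · have : c' j = τ := if_pos h
        exact Or.inl ⟨this.le, this.trans (heq j τ le_rfl h.2).symm⟩
      · have hcj : c' j = c j := if_neg h
        rcases hc j hj with h1 | h1
        · have hpos : ∃ x : ℝ, F j = x := by
            refine ⟨_, (EReal.coe_toReal ?_ ?_).symm⟩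
            · exact (h1.2 ▸ h1.1.trans_lt (EReal.coe_lt_top T)).ne
            · have ⟨_, hK⟩ := exists_rate_sched_le hγ I j
              exact (bot_le.trans_lt (release_lt_completionTime
                (fun i => measurable_share_sched γ I c i j) (hK c) (I.size_pos j hj))).ne'
          obtain ⟨x, hx⟩ := hpos
          have hcx : c j = x := h1.2.trans hx
          have hxT : (x : EReal) < τ := (hcx ▸ h1.1).trans_lt hTk
          refine Or.inl ⟨hcj.trans hcx ▸ hxT.le, ?_⟩
          rw [hcj, hcx, heq j x (EReal.coe_lt_coe_iff.1 hxT).le hx]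
        · refine Or.inr ⟨hcj.trans h1.1, hgt j (lt_of_le_of_ne (hmin j ⟨hj, h1.1⟩) fun h2 => ?_)⟩
          exact h ⟨h1.1, h2.symm⟩
    · rw [← Nat.lt_succ_iff]
      refine lt_of_lt_of_le (Finset.card_lt_card ?_) hn
      refine Finset.ssubset_iff_subset_ne.2 ⟨fun j hj => ?_, fun h => ?_⟩
      · rw [Finset.mem_filter] at hj ⊢
        refine ⟨hj.1, ?_⟩
        by_contra h
        exact h ((if_neg fun h' => h h'.1 : c' j = c j) ▸ hj.2)
      · have h1 : k ∈ ({j ∈ I.jobs | c j = ⊤} : Finset ℕ) := by simp [hk]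
        rw [← h, Finset.mem_filter] at h1
        have h2 : c' k = τ := if_pos ⟨hk.2, hτ⟩
        rw [h2] at h1
        exact EReal.coe_ne_top τ h1.2

lemma exists_completionTimes (hγ : 1 < γ) (I : JobInstance m) :
    ∃ c : ℕ → EReal, ∀ j ∈ I.jobs, c j = completionTime I (sched γ I c) j := by
  refine exists_completionTimes_aux hγ I _ (fun _ => ⊤) 0 (fun j hj => Or.inr ⟨rfl, ?_⟩) le_rfl
  have ⟨_, hK⟩ := exists_rate_sched_le hγ I j
  refine lt_of_le_of_lt ?_ (release_lt_completionTime
    (fun i => measurable_share_sched γ I _ i j) (hK _) (I.size_pos j hj))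
  exact_mod_cast (I.release j).coe_nonneg

variable (hγ : 1 < γ) (I : JobInstance m)

/-- The completion times of the jobs under the queue algorithm. -/
noncomputable def queueTimes : ℕ → EReal := (exists_completionTimes hγ I).choose

variable {I}

lemma queueTimes_eq {j : ℕ} (hj : j ∈ I.jobs) :
    queueTimes hγ I j = completionTime I (sched γ I (queueTimes hγ I)) j :=
  (exists_completionTimes hγ I).choose_spec j hj

lemma queueTimes_le_iff {j : ℕ} (hj : j ∈ I.jobs) {t : ℝ} :
    queueTimes hγ I j ≤ t ↔ CompletedBy I (sched γ I (queueTimes hγ I)) j t := by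
  rw [← completionTime_sched_le_iff hγ, ← queueTimes_eq hγ hj]

lemma mem_act_queueTimes {j : ℕ} {t : ℝ} :
    j ∈ act I (queueTimes hγ I) t ↔ Active I (sched γ I (queueTimes hγ I)) j t := by
  rw [mem_act, Active]
  refine and_congr_right fun hj => and_congr_right fun _ => ?_
  rw [← queueTimes_le_iff hγ hj, not_le]

lemma share_sched_eq_zero {c : ℕ → EReal} {i : Fin m} {j : ℕ} {t : ℝ} (h : j ∉ act I c t) :
    (sched γ I c).share i j t = 0 := if_neg fun h' => h h'.1

lemma isFeasible_sched (I : JobInstance m) : IsFeasible I (sched γ I (queueTimes hγ I)) where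
  measurable_speed := measurable_speed_sched γ I _
  measurable_share := measurable_share_sched γ I _
  locally_integrable i T := by
    refine ((lintegral_mono (g := fun _ => (((∑ j ∈ I.jobs, I.weight j) ^ (1 / γ) : ℝ≥0) : ℝ≥0∞))
      fun t => ?_).trans_lt ?_).ne
    · exact ENNReal.coe_le_coe.2 (speed_sched_le hγ I _ i t)
    · rw [setLIntegral_const]
      exact ENNReal.mul_lt_top ENNReal.coe_lt_top (by simp)
  sum_share_le i t := Config.sum_shareOf_le (by linarith) (equil_state hγ I _ t).1 _ i
  one_machine j t i i' h h' := by
    simp only [sched, Config.shareOf] at h h'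
    have h1 := (ite_ne_right_iff.1 h).1.2
    have h2 := (ite_ne_right_iff.1 h').1.2
    exact h1.symm.trans h2
  share_eq_zero i j t h := share_sched_eq_zero (mt (mem_act_queueTimes hγ).1 h)

/-- The queue algorithm: jobs migrate to the tail of another queue whenever they gain by it. -/
noncomputable def queueAlgorithm (m : ℕ) [NeZero m] : NonclairvoyantAlgorithm m where
  run I := sched γ I (queueTimes hγ I)
  feasible := isFeasible_sched hγ
  nonanticipating I I' t h := by
    have : Agree I (queueTimes hγ I) I' (queueTimes hγ I') t :=
      { released_iff := h.released_iff
        release_eq := h.release_eq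
        weight_eq := h.weight_eq
        eff_eq := h.eff_eq
        completed_iff := fun j hj hr u hu => by
          rw [queueTimes_le_iff hγ hj, queueTimes_le_iff hγ ((h.released_iff j).1 ⟨hj, hr⟩).1]
          exact h.completed_iff j hj hr u hu }
    exact ⟨this.speed_eq, this.share_eq⟩

end Fixpoint

/-! ### The dual density of a configuration. -/

namespace Config

/-- The contribution of job `j` to the dual objective per unit of time. -/
noncomputable def dual (γ : ℝ) (Q : Config m) (w : ℕ → ℝ≥0) (A : Finset ℕ) (j : ℕ) : ℝ≥0 :=
  (1 / (2 * γ)).toNNReal * Q.front w A j ^ (1 - 1 / γ) * Q.shareOf γ w A (Q.mach j) j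

variable {Q : Config m} {w : ℕ → ℝ≥0} {e : Fin m → ℕ → ℝ≥0} {A : Finset ℕ} {j : ℕ} {γ : ℝ}

lemma dual_eq_zero (hj : j ∉ A) : Q.dual γ w A j = 0 := by
  rw [dual, shareOf, if_neg fun h => hj h.1, mul_zero]

lemma dual_eq (hj : j ∈ A) : Q.dual γ w A j = (1 / (2 * γ)).toNNReal *
    Q.front w A j ^ (1 - 1 / γ) * (Q.load w A (Q.mach j) ^ (1 / γ) *
      ((Q.front w A j ^ (2 * γ) - Q.before w A j ^ (2 * γ)) /
        Q.load w A (Q.mach j) ^ (2 * γ))) := by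
  rw [dual, shareOf, if_pos ⟨hj, rfl⟩]

/-- With `x - y = w j`, the difference of powers is at most `2γ x ^ (2γ - 1) w j`. The factor `2γ`
cancels the normalisation of the dual, and the remaining powers of `x` and `W` have total degree
`2γ`, so `x ≤ W` finishes. -/
lemma dual_le (hγ : 1 < γ) (hr : Set.InjOn Q.rank A) (hj : j ∈ A) (hw : 0 < w j) :
    Q.dual γ w A j ≤ w j := by
  have hf : 0 < Q.front w A j := hw.trans_le (le_front hj)
  have hfl := Q.front_le_load w A j
  rw [dual_eq hj]
  set x := Q.front w A j with hx
  set y := Q.before w A j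
  set W := Q.load w A (Q.mach j)
  have hW : 0 < W := hf.trans_le hfl
  have hxy : x = y + w j := front_eq hr hj
  have h1 : x ^ (2 * γ) - y ^ (2 * γ) ≤ (2 * γ).toNNReal * x ^ (2 * γ - 1) * w j := by
    have := rpow_sub_rpow_le (p := 2 * γ) (by linarith) x y (by rw [hxy]; simp)
    rwa [hxy, add_tsub_cancel_left, ← hxy] at this
  have h2 : x ^ (1 - 1 / γ) * x ^ (2 * γ - 1) * W ^ (1 / γ) ≤ W ^ (2 * γ) := by
    rw [← NNReal.rpow_add hf.ne']
    have hdiv : 1 / γ ≤ 1 := by rw [div_le_one (by linarith)]; exact hγ.le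
    calc x ^ (1 - 1 / γ + (2 * γ - 1)) * W ^ (1 / γ)
        ≤ W ^ (1 - 1 / γ + (2 * γ - 1)) * W ^ (1 / γ) := by
          gcongr
          linarith
      _ = W ^ (2 * γ) := by
          rw [← NNReal.rpow_add hW.ne']
          congr 1
          ring
  have h3 : (1 / (2 * γ)).toNNReal * (2 * γ).toNNReal = 1 := by
    rw [← Real.toNNReal_mul (by positivity), one_div_mul_cancel (by linarith), Real.toNNReal_one]
  have h4 : 0 < W ^ (2 * γ) := NNReal.rpow_pos hW
  calc (1 / (2 * γ)).toNNReal * x ^ (1 - 1 / γ) *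
        (W ^ (1 / γ) * ((x ^ (2 * γ) - y ^ (2 * γ)) / W ^ (2 * γ)))
      ≤ (1 / (2 * γ)).toNNReal * x ^ (1 - 1 / γ) *
        (W ^ (1 / γ) * (((2 * γ).toNNReal * x ^ (2 * γ - 1) * w j) / W ^ (2 * γ))) := by gcongr
    _ = ((1 / (2 * γ)).toNNReal * (2 * γ).toNNReal) * w j *
        ((x ^ (1 - 1 / γ) * x ^ (2 * γ - 1) * W ^ (1 / γ)) / W ^ (2 * γ)) := by
        simp only [div_eq_mul_inv]
        ring
    _ ≤ 1 * w j * 1 := by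
        rw [h3]
        gcongr
        exact div_le_one_of_le₀ h2 zero_le
    _ = w j := by ring

/-- Up to constants the sum is a Riemann sum of `x ^ δ d(x ^ (2γ))` with right endpoints, so it
dominates the integral over `[0, W]`; `rpow_add_le_weighted` is this comparison on one step. -/
lemma le_sum_dual_queue (hγ : 1 < γ) (hr : Set.InjOn Q.rank A) (i : Fin m) :
    (1 / (2 * γ + (1 - 1 / γ))).toNNReal * Q.load w A i ≤
      ∑ j ∈ Q.queue A i, Q.dual γ w A j := by
  have h0 : 0 < γ := by linarith
  have hδ : 0 < 1 - 1 / γ := by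
    rw [sub_pos, div_lt_one h0]; exact hγ
  rcases eq_or_ne (Q.load w A i) 0 with hW | hW
  · simp [hW]
  set W := Q.load w A i with hWdef
  set p := 2 * γ with hp
  set δ := 1 - 1 / γ with hδdef
  have hp0 : 0 < p := by positivity
  have h1 : ∀ j ∈ Q.queue A i, Q.dual γ w A j = (1 / p).toNNReal * W ^ (1 / γ) / W ^ p *
      (frontOf w (Q.queue A i) Q.rank j ^ δ * (frontOf w (Q.queue A i) Q.rank j ^ p -
        beforeOf w (Q.queue A i) Q.rank j ^ p)) := by
    intro j hj
    have hj' := mem_queue.1 hj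
    rw [dual_eq hj'.1, front, before, hj'.2, ← hWdef, ← hp, ← hδdef]
    simp only [div_eq_mul_inv]
    ring
  have h2 := sum_telescope_le w (Q.queue A i) Q.rank (hr.mono fun _ h => (mem_queue.1 h).1)
    (fun x => (p / (p + δ)).toNNReal * x ^ (p + δ)) (fun x y => x ^ δ * (x ^ p - y ^ p))
    (fun x y h => rpow_add_le_weighted hp0 hδ x y h)
  simp only [NNReal.zero_rpow (by linarith : p + δ ≠ 0), mul_zero, zero_add] at h2
  rw [Finset.sum_congr rfl h1, ← Finset.mul_sum]
  refine le_trans (le_of_eq ?_) (mul_le_mul_right h2 _)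
  have h3 : (1 / (p + δ)).toNNReal = (1 / p).toNNReal * (p / (p + δ)).toNNReal := by
    rw [← Real.toNNReal_mul (by positivity)]
    congr 1
    field_simp
  have h4 : W ^ (1 / γ) * W ^ (p + δ) = W * W ^ p := by
    rw [← NNReal.rpow_add hW, ← NNReal.rpow_one_add' (by linarith : (1 : ℝ) + p ≠ 0)]
    congr 1
    rw [hδdef]
    ring
  have h5 : W ^ p ≠ 0 := (NNReal.rpow_pos (pos_iff_ne_zero.2 hW)).ne'
  change _ = (1 / p).toNNReal * W ^ (1 / γ) / W ^ p * ((p / (p + δ)).toNNReal * W ^ (p + δ))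
  calc (1 / (p + δ)).toNNReal * W
      = (1 / p).toNNReal * (p / (p + δ)).toNNReal * (W * W ^ p) / W ^ p := by
        rw [h3]; field_simp
    _ = _ := by rw [← h4]; field_simp

lemma sum_load (Q : Config m) (w : ℕ → ℝ≥0) (A : Finset ℕ) :
    ∑ i, Q.load w A i = ∑ j ∈ A, w j :=
  Finset.sum_fiberwise A Q.mach w

lemma le_sum_dual (hγ : 1 < γ) (hr : Set.InjOn Q.rank A) :
    (1 / (2 * γ + (1 - 1 / γ))).toNNReal * ∑ j ∈ A, w j ≤ ∑ j ∈ A, Q.dual γ w A j := by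
  rw [← sum_load Q, Finset.mul_sum, ← Finset.sum_fiberwise A Q.mach fun j => Q.dual γ w A j]
  exact Finset.sum_le_sum fun i _ => le_sum_dual_queue hγ hr i

/-- The dual constraint, for a job whose utility is at least that of a position with weight `x`. -/
lemma eff_mul_dual_le (hj : j ∈ A) (hw : 0 < w j) {x : ℝ≥0} (hx : 0 < x) {i : Fin m}
    (h : e i j / x ^ (1 - 1 / γ) ≤ Q.util (1 - 1 / γ) w e A j) :
    e i j * Q.dual γ w A j ≤ (1 / (2 * γ)).toNNReal * x ^ (1 - 1 / γ) *
      (e (Q.mach j) j * Q.shareOf γ w A (Q.mach j) j) := by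
  have hf : 0 < Q.front w A j ^ (1 - 1 / γ) := NNReal.rpow_pos (hw.trans_le (le_front hj))
  rw [util, div_le_div_iff₀ (NNReal.rpow_pos hx) hf] at h
  rw [dual]
  calc e i j * ((1 / (2 * γ)).toNNReal * Q.front w A j ^ (1 - 1 / γ) *
        Q.shareOf γ w A (Q.mach j) j)
      = (1 / (2 * γ)).toNNReal * (e i j * Q.front w A j ^ (1 - 1 / γ)) *
        Q.shareOf γ w A (Q.mach j) j := by ring
    _ ≤ (1 / (2 * γ)).toNNReal * (e (Q.mach j) j * x ^ (1 - 1 / γ)) *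
        Q.shareOf γ w A (Q.mach j) j := by gcongr
    _ = _ := by ring

end Config

/-! ### Estimates for an arbitrary feasible schedule. -/

section Offline

variable {I : JobInstance m} {S : Schedule m} {j : ℕ} {t : ℝ}

lemma active_of_share_ne_zero (hS : IsFeasible I S) {i : Fin m} (h : S.share i j t ≠ 0) :
    Active I S j t := by
  by_contra h'
  exact h (hS.share_eq_zero i j t h')

lemma ofReal_sub_le_flowTime (h : Active I S j t) :
    ENNReal.ofReal (t - I.release j) ≤ flowTime I S j := by
  refine le_iInf₂ fun d hd => ?_
  have : t < I.release j + d := by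
    by_contra! hle
    exact h.2.2 (hd.mono hle)
  rw [← ENNReal.ofReal_coe_nnreal]
  exact ENNReal.ofReal_le_ofReal (by linarith)

lemma exists_completedBy (h : flowTime I S j ≠ ∞) : ∃ t, CompletedBy I S j t := by
  by_contra! hno
  refine h (top_le_iff.1 (le_iInf₂ fun d hd => absurd hd (hno _)))

/-- The times at which job `j` is processed. -/
def busy (S : Schedule m) (j : ℕ) : Set ℝ := {t | ∃ i, S.share i j t ≠ 0}

lemma measurableSet_busy (hS : IsFeasible I S) (j : ℕ) : MeasurableSet (busy S j) := by
  have : busy S j = ⋃ i, (S.share i j ⁻¹' {0})ᶜ := by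
    ext t
    simp [busy]
  rw [this]
  exact MeasurableSet.iUnion fun i => (hS.measurable_share i j (measurableSet_singleton 0)).compl

/-- A job is processed only while it is active, thus between its release and any time at which it is
complete. -/
lemma volume_busy_le (hS : IsFeasible I S) (j : ℕ) : volume (busy S j) ≤ flowTime I S j := by
  refine le_iInf₂ fun d hd => ?_
  have hsub : busy S j ⊆ Set.Ico (I.release j : ℝ) (I.release j + d) := by
    rintro t ⟨i, hi⟩
    have h := active_of_share_ne_zero hS hi
    refine ⟨h.2.1, ?_⟩
    by_contra! hle
    exact h.2.2 (hd.mono hle)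
  refine (measure_mono hsub).trans ?_
  simp

lemma lintegral_indicator_busy_le {S : Schedule m} (hS : IsFeasible I S) (j : ℕ) :
    ∫⁻ t in Set.Ici (0 : ℝ), ((busy S j).indicator (fun _ => I.weight j) t : ℝ≥0) ≤
      I.weight j * flowTime I S j := by
  simp_rw [ENNReal.coe_indicator]
  refine (setLIntegral_le_lintegral _ _).trans ?_
  rw [lintegral_indicator_const (measurableSet_busy hS j)]
  exact mul_le_mul_right (volume_busy_le hS j) _

/-- Young's inequality for the jobs processed on their own: each job is on one machine only. -/
lemma sum_share_mul_rpow_le {γ : ℝ} (hγ : 1 < γ) (hS : IsFeasible I S) (t : ℝ) :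
    ∑ j ∈ I.jobs, ∑ i, S.share i j t * I.weight j ^ (1 - 1 / γ) ≤
      ∑ i, S.speed i t ^ γ + ∑ j ∈ I.jobs, (busy S j).indicator (fun _ => I.weight j) t := by
  have h0 : 0 < γ := by linarith
  have hg : (1 / γ).toNNReal ≤ 1 := by
    rw [Real.toNNReal_le_one, div_le_one h0]; exact hγ.le
  have hg' : (1 - 1 / γ).toNNReal ≤ 1 := by
    rw [Real.toNNReal_le_one]
    have : 0 < 1 / γ := by positivity
    linarith
  have h1 : ∀ j ∈ I.jobs, ∑ i, S.share i j t * I.weight j ^ (1 - 1 / γ) ≤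
      ∑ i, S.share i j t ^ γ + (busy S j).indicator (fun _ => I.weight j) t := by
    intro j _
    by_cases hb : t ∈ busy S j
    · obtain ⟨i, hi⟩ := hb
      have hz : ∀ k, k ≠ i → S.share k j t = 0 := fun k hk => by
        by_contra h
        exact hk (hS.one_machine j t k i h hi)
      rw [Set.indicator_of_mem (show t ∈ busy S j from ⟨i, hi⟩),
        Finset.sum_eq_single i (fun k _ hk => by rw [hz k hk, zero_mul]) (by simp)]
      refine (mul_rpow_le_young hγ _ _).trans (add_le_add ?_ ?_)
      · refine (mul_le_of_le_one_left zero_le hg).trans ?_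
        exact Finset.single_le_sum (f := fun k => S.share k j t ^ γ) (fun _ _ => zero_le)
          (Finset.mem_univ i)
      · exact mul_le_of_le_one_left zero_le hg'
    · have hz : ∀ k, S.share k j t = 0 := fun k => by
        by_contra h
        exact hb ⟨k, h⟩
      simp [hz]
  -- Superadditivity of `s ^ γ`: splitting the speed among jobs does not increase the sum of the
  -- `γ`-th powers.
  have h2 : ∀ i, ∑ j ∈ I.jobs, S.share i j t ^ γ ≤ S.speed i t ^ γ := by
    intro i
    have hsplit : ∀ x : ℝ≥0, x ^ γ = x * x ^ (γ - 1) := fun x => by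
      rw [← NNReal.rpow_one_add' (by linarith : 1 + (γ - 1) ≠ 0)]
      congr 1
      ring
    have hle : ∀ j ∈ I.jobs, S.share i j t ^ γ ≤ S.share i j t * S.speed i t ^ (γ - 1) := by
      intro j hj
      rw [hsplit]
      have : S.share i j t ≤ S.speed i t :=
        (Finset.single_le_sum (f := fun j => S.share i j t) (fun _ _ => zero_le) hj).trans
          (hS.sum_share_le i t)
      have h1 : 0 ≤ γ - 1 := by linarith
      gcongr
    refine (Finset.sum_le_sum hle).trans ?_
    rw [← Finset.sum_mul, hsplit (S.speed i t)]
    gcongr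
    exact hS.sum_share_le i t
  calc ∑ j ∈ I.jobs, ∑ i, S.share i j t * I.weight j ^ (1 - 1 / γ)
      ≤ ∑ j ∈ I.jobs, (∑ i, S.share i j t ^ γ + (busy S j).indicator (fun _ => I.weight j) t) :=
        Finset.sum_le_sum h1
    _ = ∑ i, ∑ j ∈ I.jobs, S.share i j t ^ γ +
        ∑ j ∈ I.jobs, (busy S j).indicator (fun _ => I.weight j) t := by
        rw [Finset.sum_add_distrib, Finset.sum_comm]
    _ ≤ _ := by
        gcongr with i
        exact h2 i

/-- Young's inequality for the speeds of the machines against their loads. -/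
lemma sum_share_mul_load_le {γ : ℝ} (hγ : 1 < γ) (hS : IsFeasible I S) (t : ℝ) (W : Fin m → ℝ≥0) :
    ∑ j ∈ I.jobs, ∑ i, S.share i j t * W i ^ (1 - 1 / γ) ≤
      ∑ i, S.speed i t ^ γ + (1 - 1 / γ).toNNReal * ∑ i, W i := by
  have h0 : 0 < γ := by linarith
  have hg : (1 / γ).toNNReal ≤ 1 := by
    rw [Real.toNNReal_le_one, div_le_one h0]; exact hγ.le
  rw [Finset.sum_comm, Finset.mul_sum, ← Finset.sum_add_distrib]
  refine Finset.sum_le_sum fun i _ => ?_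
  rw [← Finset.sum_mul]
  calc (∑ j ∈ I.jobs, S.share i j t) * W i ^ (1 - 1 / γ)
      ≤ S.speed i t * W i ^ (1 - 1 / γ) := by
        gcongr
        exact hS.sum_share_le i t
    _ ≤ _ := mul_rpow_le_young hγ _ _
    _ ≤ _ := by
        gcongr
        exact mul_le_of_le_one_left zero_le hg

end Offline

/-! ### Loads and dual densities over time. -/

section Online

variable [NeZero m] {γ : ℝ}

/-- The load of machine `i` at time `t`. -/
noncomputable def loadAt (γ : ℝ) (I : JobInstance m) (c : ℕ → EReal) (i : Fin m) (t : ℝ) : ℝ≥0 :=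
  (state γ I c t).load I.weight (act I c t) i

/-- The contribution of job `j` to the dual objective at time `t`. -/
noncomputable def dualAt (γ : ℝ) (I : JobInstance m) (c : ℕ → EReal) (j : ℕ) (t : ℝ) : ℝ≥0 :=
  (state γ I c t).dual γ I.weight (act I c t) j

variable {I : JobInstance m} {c : ℕ → EReal} {j : ℕ} {t u : ℝ}

lemma measurable_loadAt (γ : ℝ) (I : JobInstance m) (c : ℕ → EReal) (i : Fin m) :
    Measurable (loadAt γ I c i) := by
  have := measurable_comp_filter_le (allEvents I c) fun E =>
    let L := (E.sort (· ≥ ·)).map (act I c)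
    (Config.ofHistory (1 - 1 / γ) I.weight I.eff L).load I.weight (L.headD ∅) i
  convert this using 2 with t
  simp only [loadAt, ← headD_hist I c t]
  rfl

lemma measurable_dualAt (γ : ℝ) (I : JobInstance m) (c : ℕ → EReal) (j : ℕ) :
    Measurable (dualAt γ I c j) := by
  have := measurable_comp_filter_le (allEvents I c) fun E =>
    let L := (E.sort (· ≥ ·)).map (act I c)
    (Config.ofHistory (1 - 1 / γ) I.weight I.eff L).dual γ I.weight (L.headD ∅) j
  convert this using 2 with t
  simp only [dualAt, ← headD_hist I c t]
  rfl

lemma dualAt_eq_zero (h : j ∉ act I c t) : dualAt γ I c j t = 0 := Config.dual_eq_zero h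

lemma dualAt_le (hγ : 1 < γ) (hj : j ∈ I.jobs) : dualAt γ I c j t ≤ I.weight j := by
  by_cases h : j ∈ act I c t
  · exact Config.dual_le hγ (equil_state hγ I c t).1 h (I.weight_pos j hj)
  · rw [dualAt_eq_zero h]
    exact zero_le

lemma sum_loadAt (γ : ℝ) (I : JobInstance m) (c : ℕ → EReal) (t : ℝ) :
    ∑ i, loadAt γ I c i t = ∑ j ∈ act I c t, I.weight j := Config.sum_load _ _ _

lemma le_sum_dualAt (hγ : 1 < γ) :
    (1 / (2 * γ + (1 - 1 / γ))).toNNReal * ∑ i, loadAt γ I c i t ≤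
      ∑ j ∈ I.jobs, dualAt γ I c j t := by
  rw [sum_loadAt]
  refine (Config.le_sum_dual hγ (equil_state hγ I c t).1).trans ?_
  exact Finset.sum_le_sum_of_subset fun j hj => (mem_act.1 hj).1

/-- The dual constraint: it rests on the equilibrium at time `t` and on the monotonicity of the
utilities. -/
lemma eff_mul_dualAt_le (hγ : 1 < γ) (hj : j ∈ I.jobs) (ht : I.release j ≤ t) (htu : t ≤ u)
    (i : Fin m) :
    I.eff i j * dualAt γ I c j u ≤ (1 / (2 * γ)).toNNReal *
      (loadAt γ I c i t + I.weight j) ^ (1 - 1 / γ) * rate I (sched γ I c) j u := by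
  by_cases hu : j ∈ act I c u
  swap
  · rw [dualAt_eq_zero hu, mul_zero]
    exact zero_le
  have hw := I.weight_pos j hj
  have ht' : j ∈ act I c t := by
    rw [mem_act] at hu ⊢
    exact ⟨hj, ht, lt_of_le_of_lt (EReal.coe_le_coe_iff.2 htu) hu.2.2⟩
  refine (Config.eff_mul_dual_le hu hw (x := loadAt γ I c i t + I.weight j) (i := i)
    (hw.trans_le (by simp)) (((equil_state hγ I c t).2 j ht' i).trans
      (util_state_mono hγ htu ht' hu))).trans ?_
  gcongr
  exact Finset.single_le_sum (f := fun i => I.eff i j * (sched γ I c).share i j u)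
    (fun _ _ => zero_le) (Finset.mem_univ _)

end Online

/-! ### Weak duality and the competitive ratio. -/

section Duality

variable [NeZero m] {γ : ℝ} (hγ : 1 < γ) {I : JobInstance m} {j : ℕ}

/-- The load of machine `i` up to time `T`. -/
noncomputable def loadUpTo (γ : ℝ) (I : JobInstance m) (c : ℕ → EReal) (T : ℝ) (i : Fin m) :
    ℝ → ℝ≥0 :=
  (Set.Iic T).indicator (loadAt γ I c i)

lemma measurable_loadUpTo (γ : ℝ) (I : JobInstance m) (c : ℕ → EReal) (T : ℝ) (i : Fin m) :
    Measurable (loadUpTo γ I c T i) :=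
  (measurable_loadAt γ I c i).indicator measurableSet_Iic

lemma lintegral_dualAt_le {c : ℕ → EReal} (T t : ℝ) :
    ∫⁻ u in Set.Icc 0 T, (dualAt γ I c j u : ℝ≥0∞) ≤
      (∫⁻ u in Set.Icc (I.release j : ℝ) t, (dualAt γ I c j u : ℝ≥0∞)) +
        ∫⁻ u in Set.Icc t T, (dualAt γ I c j u : ℝ≥0∞) := by
  have h1 : (fun u => (dualAt γ I c j u : ℝ≥0∞)) =
      (Set.Ici (I.release j : ℝ)).indicator fun u => (dualAt γ I c j u : ℝ≥0∞) := by
    funext u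
    by_cases hu : u ∈ Set.Ici (I.release j : ℝ)
    · rw [Set.indicator_of_mem hu]
    · rw [Set.indicator_of_notMem hu, dualAt_eq_zero fun h => hu (mem_act.1 h).2.1]
      rfl
  have hsub : Set.Ici (I.release j : ℝ) ∩ Set.Icc 0 T ⊆
      Set.Icc (I.release j : ℝ) t ∪ Set.Icc t T := by
    rintro x ⟨h1, h2⟩
    rcases le_total x t with h | h
    · exact Or.inl ⟨h1, h⟩
    · exact Or.inr ⟨h, h2.2⟩
  calc ∫⁻ u in Set.Icc 0 T, (dualAt γ I c j u : ℝ≥0∞)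
      = ∫⁻ u in Set.Ici (I.release j : ℝ) ∩ Set.Icc 0 T, (dualAt γ I c j u : ℝ≥0∞) := by
        rw [h1, setLIntegral_indicator measurableSet_Ici, ← h1]
    _ ≤ _ := (lintegral_mono_set hsub).trans (lintegral_union_le _ _ _)

lemma rate_sched_eq_zero {u : ℝ}
    (h : CompletedBy I (sched γ I (queueTimes hγ I)) j u) :
    rate I (sched γ I (queueTimes hγ I)) j u = 0 :=
  Finset.sum_eq_zero fun i _ => by
    rw [share_sched_eq_zero fun h' => ((mem_act_queueTimes hγ).1 h').2.2 h, mul_zero]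

/-- The integrated dual constraint. -/
lemma eff_mul_lintegral_dualAt_le (hj : j ∈ I.jobs) {t : ℝ} (ht : I.release j ≤ t) (T : ℝ)
    (i : Fin m) :
    I.eff i j * ∫⁻ u in Set.Icc 0 T, (dualAt γ I (queueTimes hγ I) j u : ℝ≥0∞) ≤
      I.eff i j * (I.weight j * ENNReal.ofReal (t - I.release j)) +
      I.size j * (((1 / (2 * γ)).toNNReal * (loadUpTo γ I (queueTimes hγ I) T i t ^ (1 - 1 / γ) +
        I.weight j ^ (1 - 1 / γ)) : ℝ≥0) : ℝ≥0∞) := by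
  set c := queueTimes hγ I
  have hmeas := fun i => measurable_share_sched γ I c i j
  obtain ⟨B, hB⟩ := exists_rate_sched_le hγ I j
  refine (mul_le_mul_right (lintegral_dualAt_le T t) _).trans ?_
  rw [mul_add]
  refine add_le_add (mul_le_mul_right ?_ _) ?_
  · calc ∫⁻ u in Set.Icc (I.release j : ℝ) t, (dualAt γ I c j u : ℝ≥0∞)
        ≤ ∫⁻ _ in Set.Icc (I.release j : ℝ) t, (I.weight j : ℝ≥0∞) :=
          lintegral_mono fun u => ENNReal.coe_le_coe.2 (dualAt_le hγ hj)
      _ = _ := by simp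
  -- For `t > T` the tail integral is empty. This is why the load may be cut off at `T`.
  · rcases lt_or_ge T t with h | h
    · simp [Set.Icc_eq_empty h.not_ge]
    · have hl : loadUpTo γ I c T i t = loadAt γ I c i t := Set.indicator_of_mem (by exact h) _
      set y : ℝ≥0 := (1 / (2 * γ)).toNNReal *
        (loadAt γ I c i t + I.weight j) ^ (1 - 1 / γ) with hy
      have hy' : y ≤ (1 / (2 * γ)).toNNReal * (loadUpTo γ I c T i t ^ (1 - 1 / γ) +
          I.weight j ^ (1 - 1 / γ)) := by
        rw [hl, hy]
        gcongr
        -- Subadditivity of `x ^ δ` separates the load from the weight of the job, which are charged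
        -- differently afterwards.
        refine NNReal.rpow_add_le_add_rpow _ _ (one_sub_inv_nonneg hγ) ?_
        have : 0 < 1 / γ := by positivity
        linarith
      calc I.eff i j * ∫⁻ u in Set.Icc t T, (dualAt γ I c j u : ℝ≥0∞)
          = ∫⁻ u in Set.Icc t T, I.eff i j * (dualAt γ I c j u : ℝ≥0∞) :=
            (lintegral_const_mul _ (measurable_dualAt γ I c j).coe_nnreal_ennreal).symm
        _ ≤ ∫⁻ u in Set.Icc t T, (y : ℝ≥0∞) * (rate I (sched γ I c) j u : ℝ≥0∞) := by
            refine setLIntegral_mono' measurableSet_Icc fun u hu => ?_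
            rw [← ENNReal.coe_mul, ← ENNReal.coe_mul, ENNReal.coe_le_coe]
            exact eff_mul_dualAt_le hγ hj ht hu.1 i
        _ = y * ∫⁻ u in Set.Icc t T, (rate I (sched γ I c) j u : ℝ≥0∞) :=
            lintegral_const_mul _ (measurable_rate hmeas).coe_nnreal_ennreal
        _ ≤ y * I.size j := by
            gcongr
            refine (lintegral_mono_set (Set.Icc_subset_Icc_left ht)).trans ?_
            rw [← work_eq_lintegral hmeas]
            exact work_le_size hmeas (hB c) (fun u hu => rate_sched_eq_zero hγ hu) (ht.trans h)
        _ ≤ _ := by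
            rw [mul_comm]
            gcongr

/-- The dual value of a job is paid for by its flow-time in any other schedule and by the work
done on it there. -/
lemma lintegral_dualAt_le_of_isFeasible {S : Schedule m} (hS : IsFeasible I S) (hj : j ∈ I.jobs)
    (hX : flowTime I S j ≠ ∞) (T : ℝ) :
    ∫⁻ u in Set.Icc 0 T, (dualAt γ I (queueTimes hγ I) j u : ℝ≥0∞) ≤
      I.weight j * flowTime I S j + (1 / (2 * γ)).toNNReal * ∫⁻ t in Set.Ici 0,
        ((∑ i, S.share i j t * (loadUpTo γ I (queueTimes hγ I) T i t ^ (1 - 1 / γ) +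
          I.weight j ^ (1 - 1 / γ)) : ℝ≥0) : ℝ≥0∞) := by
  set c := queueTimes hγ I
  set K := ∫⁻ u in Set.Icc 0 T, (dualAt γ I c j u : ℝ≥0∞)
  set b := (1 / (2 * γ)).toNNReal
  set z : Fin m → ℝ → ℝ≥0 := fun i t =>
    loadUpTo γ I c T i t ^ (1 - 1 / γ) + I.weight j ^ (1 - 1 / γ) with hz
  have hzm : Measurable fun t => ∑ i, S.share i j t * z i t :=
    Finset.measurable_fun_sum _ fun i _ => (hS.measurable_share i j).mul
      (((measurable_loadUpTo γ I c T i).pow_const _).add_const _)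
  -- The excess `D` over the weighted flow-time does not depend on `t`, so the pointwise bound can
  -- be weighted by the shares of `S` and integrated; `S` does at least the size of `j` in work, and
  -- the size then cancels.
  rw [← tsub_le_iff_left]
  set D := K - I.weight j * flowTime I S j
  have hpt : ∀ i t, ((I.eff i j * S.share i j t : ℝ≥0) : ℝ≥0∞) * D ≤
      I.size j * (b * ((S.share i j t * z i t : ℝ≥0) : ℝ≥0∞)) := by
    intro i t
    by_cases h : S.share i j t = 0
    · simp [h]
    have hact := active_of_share_ne_zero hS h
    have h1 : I.eff i j * D ≤ I.size j * (b * z i t : ℝ≥0) := by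
      rw [ENNReal.mul_sub fun _ _ => ENNReal.coe_ne_top, tsub_le_iff_left]
      refine (eff_mul_lintegral_dualAt_le hγ hj hact.2.1 T i).trans ?_
      gcongr
      exact ofReal_sub_le_flowTime hact
    calc ((I.eff i j * S.share i j t : ℝ≥0) : ℝ≥0∞) * D
        = S.share i j t * (I.eff i j * D) := by push_cast; ring
      _ ≤ S.share i j t * (I.size j * (b * z i t : ℝ≥0)) := by gcongr
      _ = _ := by push_cast; ring
  obtain ⟨t₁, ht₁⟩ := exists_completedBy hX
  have hp : (I.size j : ℝ≥0∞) ≠ 0 := by simpa using (I.size_pos j hj).ne'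
  refine (ENNReal.mul_le_mul_iff_right hp ENNReal.coe_ne_top).1 ?_
  calc (I.size j : ℝ≥0∞) * D ≤ work I S j t₁ * D := mul_le_mul_left ht₁.2 _
    _ = ∫⁻ t in Set.Icc (I.release j : ℝ) t₁, (rate I S j t : ℝ≥0∞) * D := by
        rw [work_eq_lintegral fun i => hS.measurable_share i j, lintegral_mul_const]
        exact (measurable_rate fun i => hS.measurable_share i j).coe_nnreal_ennreal
    _ ≤ ∫⁻ t in Set.Icc (I.release j : ℝ) t₁,
        I.size j * (b * ((∑ i, S.share i j t * z i t : ℝ≥0) : ℝ≥0∞)) := by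
        refine lintegral_mono fun t => ?_
        rw [rate]
        push_cast
        rw [Finset.sum_mul, Finset.mul_sum, Finset.mul_sum]
        refine Finset.sum_le_sum fun i _ => ?_
        have := hpt i t
        push_cast at this
        exact this
    _ ≤ ∫⁻ t in Set.Ici 0,
        I.size j * (b * ((∑ i, S.share i j t * z i t : ℝ≥0) : ℝ≥0∞)) :=
        lintegral_mono_set fun t ht => (I.release j).coe_nonneg.trans ht.1
    _ = I.size j * (b * ∫⁻ t in Set.Ici 0, ((∑ i, S.share i j t * z i t : ℝ≥0) : ℝ≥0∞)) := by
        rw [lintegral_const_mul _ (hzm.coe_nnreal_ennreal.const_mul _),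
          lintegral_const_mul _ hzm.coe_nnreal_ennreal]

lemma lintegral_sum_loadUpTo (c : ℕ → EReal) (T : ℝ) :
    ∫⁻ t in Set.Ici (0 : ℝ), ((∑ i, loadUpTo γ I c T i t : ℝ≥0) : ℝ≥0∞) =
      ∫⁻ t in Set.Icc 0 T, ((∑ i, loadAt γ I c i t : ℝ≥0) : ℝ≥0∞) := by
  have h : (fun t => ((∑ i, loadUpTo γ I c T i t : ℝ≥0) : ℝ≥0∞)) =
      (Set.Iic T).indicator fun t => ((∑ i, loadAt γ I c i t : ℝ≥0) : ℝ≥0∞) := by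
    funext t
    by_cases ht : t ∈ Set.Iic T
    · simp [loadUpTo, Set.indicator_of_mem ht]
    · simp [loadUpTo, Set.indicator_of_notMem ht]
  rw [h, setLIntegral_indicator measurableSet_Iic, Set.Iic_inter_Ici]

/-- Needed to cancel the load term that reappears on the other side of the duality estimate; it is
the reason for first working up to a finite `T`. -/
lemma lintegral_sum_loadAt_ne_top (c : ℕ → EReal) (T : ℝ) :
    ∫⁻ t in Set.Icc 0 T, ((∑ i, loadAt γ I c i t : ℝ≥0) : ℝ≥0∞) ≠ ∞ := by
  refine ((lintegral_mono (g := fun _ => ((∑ j ∈ I.jobs, I.weight j : ℝ≥0) : ℝ≥0∞))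
    fun t => ?_).trans_lt ?_).ne
  · rw [sum_loadAt]
    exact ENNReal.coe_le_coe.2 (Finset.sum_le_sum_of_subset fun j hj => (mem_act.1 hj).1)
  · rw [setLIntegral_const]
    exact ENNReal.mul_lt_top ENNReal.coe_lt_top (by simp)

/-- With `δ = 1 - 1 / γ`, the gap `1 / (2γ + δ) - δ / (2γ)` equals `(2 - δ²) / (2γ (2γ + δ))`; here
`δ² ≤ 1` and `2γ + δ ≤ 3γ`. The exponent `2γ` in the shares makes this gap positive. -/
lemma coefficient_le (hγ : 1 < γ) :
    (1 / (6 * γ ^ 2)).toNNReal + (1 / (2 * γ)).toNNReal * (1 - 1 / γ).toNNReal ≤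
      (1 / (2 * γ + (1 - 1 / γ))).toNNReal := by
  have h0 : 0 < γ := by linarith
  have hδ := one_sub_inv_nonneg hγ
  rw [← Real.toNNReal_mul (by positivity),
    ← Real.toNNReal_add (by positivity) (by positivity)]
  refine Real.toNNReal_le_toNNReal ?_
  obtain ⟨x, hx⟩ : ∃ x, x = 1 / γ := ⟨_, rfl⟩
  have hx0 : 0 < x := by rw [hx]; positivity
  rw [← hx] at hδ ⊢
  have h1 : 1 / (2 * γ) = x / 2 := by rw [hx]; field_simp
  have h2 : 1 / (6 * γ ^ 2) = x ^ 2 / 6 := by rw [hx]; field_simp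
  have h3 : γ * x = 1 := by rw [hx]; field_simp
  have hpos : 0 < 2 * γ + (1 - x) := by linarith
  rw [h1, h2, le_div_iff₀ hpos]
  have h4 : (x ^ 2 / 6 + x / 2 * (1 - x)) * (2 * γ + (1 - x)) =
      1 - 2 * x / 3 + x * (1 - x) * (x / 6 + (1 - x) / 2) := by
    linear_combination (x / 3 + (1 - x)) * h3
  rw [h4]
  nlinarith [mul_nonneg hx0.le hδ, mul_nonneg (mul_nonneg hx0.le hδ) hx0.le,
    mul_nonneg (mul_nonneg hx0.le hδ) hδ]

variable (I)

/-- Weak duality, up to time `T`. -/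
lemma lintegral_sum_loadAt_Icc_le {S : Schedule m} (hS : IsFeasible I S) (T : ℝ) :
    (1 / (6 * γ ^ 2)).toNNReal *
      ∫⁻ t in Set.Icc 0 T, ((∑ i, loadAt γ I (queueTimes hγ I) i t : ℝ≥0) : ℝ≥0∞) ≤
      2 * cost (fun _ s => s ^ γ) I S := by
  by_cases hX : ∃ j ∈ I.jobs, flowTime I S j = ∞
  · obtain ⟨j, hj, hX⟩ := hX
    have : cost (fun _ s => s ^ γ) I S = ∞ := by
      rw [cost, ENNReal.add_eq_top, ENNReal.sum_eq_top]
      refine Or.inl ⟨j, hj, ?_⟩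
      rw [hX]
      exact ENNReal.mul_top (by simpa using (I.weight_pos j hj).ne')
    rw [this, ENNReal.mul_top (by simp)]
    exact le_top
  push Not at hX
  set c := queueTimes hγ I
  set V := ∫⁻ t in Set.Icc 0 T, ((∑ i, loadAt γ I c i t : ℝ≥0) : ℝ≥0∞) with hV
  set b := (1 / (2 * γ)).toNNReal
  set δ := 1 - 1 / γ with hδ
  set F := ∑ j ∈ I.jobs, (I.weight j : ℝ≥0∞) * flowTime I S j with hF
  set En := energy (fun _ s => s ^ γ) S with hEn
  have hVtop : V ≠ ∞ := lintegral_sum_loadAt_ne_top c T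
  have hb : (b : ℝ≥0∞) * 2 ≤ 1 := by
    have : b * 2 ≤ 1 := by
      rw [← NNReal.coe_le_coe]
      push_cast
      rw [Real.coe_toNNReal _ (by positivity), div_mul_eq_mul_div, div_le_one (by linarith)]
      linarith
    exact_mod_cast this
  have hb' : (b : ℝ≥0∞) ≤ 1 := le_trans (by rw [mul_two]; simp) hb
  have hspeed : Measurable fun t => ∑ i, S.speed i t ^ γ :=
    Finset.measurable_fun_sum _ fun i _ => (hS.measurable_speed i).pow_const _
  have hload : Measurable fun t => ∑ i, loadUpTo γ I c T i t :=
    Finset.measurable_fun_sum _ fun i _ => measurable_loadUpTo γ I c T i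
  have hbusy : ∀ j, Measurable ((busy S j).indicator fun _ => I.weight j) := fun j =>
    measurable_const.indicator (measurableSet_busy hS j)
  have hEn' : ∫⁻ t in Set.Ici (0 : ℝ), ((∑ i, S.speed i t ^ γ : ℝ≥0) : ℝ≥0∞) = En := by
    rw [hEn, energy, ← lintegral_finsetSum]
    · push_cast
      rfl
    · exact fun i _ => ((hS.measurable_speed i).pow_const _).coe_nnreal_ennreal
  have hlow : (1 / (2 * γ + δ)).toNNReal * V ≤
      ∑ j ∈ I.jobs, ∫⁻ u in Set.Icc 0 T, (dualAt γ I c j u : ℝ≥0∞) := by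
    rw [← lintegral_finsetSum _ fun j _ => (measurable_dualAt γ I c j).coe_nnreal_ennreal, hV,
      ← lintegral_const_mul' _ _ ENNReal.coe_ne_top]
    refine lintegral_mono fun t => ?_
    have := ENNReal.coe_le_coe.2 (le_sum_dualAt (c := c) (I := I) (t := t) hγ)
    push_cast at this ⊢
    exact this
  have hup : ∑ j ∈ I.jobs, ∫⁻ u in Set.Icc 0 T, (dualAt γ I c j u : ℝ≥0∞) ≤
      F + b * (En + En + F + δ.toNNReal * V) := by
    refine (Finset.sum_le_sum fun j hj =>
      lintegral_dualAt_le_of_isFeasible hγ hS hj (hX j hj) T).trans ?_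
    rw [Finset.sum_add_distrib, ← Finset.mul_sum]
    gcongr
    rw [← lintegral_finsetSum]
    swap
    · exact fun j _ => (Finset.measurable_fun_sum _ fun i _ => (hS.measurable_share i j).mul
        (((measurable_loadUpTo γ I c T i).pow_const _).add_const _)).coe_nnreal_ennreal
    calc ∫⁻ t in Set.Ici 0, ∑ j ∈ I.jobs, ((∑ i, S.share i j t *
          (loadUpTo γ I c T i t ^ δ + I.weight j ^ δ) : ℝ≥0) : ℝ≥0∞)
        ≤ ∫⁻ t in Set.Ici 0, (((∑ i, S.speed i t ^ γ : ℝ≥0) : ℝ≥0∞) +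
            (δ.toNNReal : ℝ≥0∞) * ((∑ i, loadUpTo γ I c T i t : ℝ≥0) : ℝ≥0∞) +
            (((∑ i, S.speed i t ^ γ : ℝ≥0) : ℝ≥0∞) +
            ∑ j ∈ I.jobs, (((busy S j).indicator (fun _ => I.weight j) t : ℝ≥0) : ℝ≥0∞))) := by
          refine lintegral_mono fun t => ?_
          have h1 := sum_share_mul_load_le hγ hS t fun i => loadUpTo γ I c T i t
          have h2 := sum_share_mul_rpow_le hγ hS t
          have h3 := add_le_add h1 h2
          simp_rw [← Finset.sum_add_distrib, ← mul_add] at h3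
          have h4 := ENNReal.coe_le_coe.2 h3
          push_cast at h4 ⊢
          exact h4
      _ = En + δ.toNNReal * V + (En + ∑ j ∈ I.jobs, ∫⁻ t in Set.Ici (0 : ℝ),
            (((busy S j).indicator (fun _ => I.weight j) t : ℝ≥0) : ℝ≥0∞)) := by
          rw [lintegral_add_left, lintegral_add_left hspeed.coe_nnreal_ennreal,
            lintegral_add_left hspeed.coe_nnreal_ennreal,
            lintegral_const_mul _ hload.coe_nnreal_ennreal, hEn', lintegral_sum_loadUpTo,
            lintegral_finsetSum _ fun j _ => (hbusy j).coe_nnreal_ennreal]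
          exact hspeed.coe_nnreal_ennreal.add (hload.coe_nnreal_ennreal.const_mul _)
      _ ≤ En + δ.toNNReal * V + (En + F) := by
          gcongr
          exact Finset.sum_le_sum fun j _ => lintegral_indicator_busy_le hS j
      _ = _ := by ring
  have hcoef : ((1 / (6 * γ ^ 2)).toNNReal : ℝ≥0∞) + b * δ.toNNReal ≤
      (1 / (2 * γ + δ)).toNNReal := by
    exact_mod_cast coefficient_le hγ
  have hfin : (b : ℝ≥0∞) * δ.toNNReal * V ≠ ∞ :=
    ENNReal.mul_ne_top (ENNReal.mul_ne_top ENNReal.coe_ne_top ENNReal.coe_ne_top) hVtop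
  -- The load term coming from Young's inequality is added to both sides so that it can be absorbed
  -- by the dual lower bound.
  refine (ENNReal.add_le_add_iff_right hfin).1 ?_
  calc ((1 / (6 * γ ^ 2)).toNNReal : ℝ≥0∞) * V + b * δ.toNNReal * V
      = (((1 / (6 * γ ^ 2)).toNNReal : ℝ≥0∞) + b * δ.toNNReal) * V := by ring
    _ ≤ (1 / (2 * γ + δ)).toNNReal * V := by gcongr
    _ ≤ F + b * (En + En + F + δ.toNNReal * V) := hlow.trans hup
    _ = F + (b * 2) * En + b * F + b * δ.toNNReal * V := by ring
    _ ≤ F + 1 * (2 * En) + 1 * F + b * δ.toNNReal * V := by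
        gcongr
        rw [two_mul]
        simp
    _ = 2 * cost (fun _ s => s ^ γ) I S + b * δ.toNNReal * V := by
        rw [cost, ← hF, ← hEn]
        ring

lemma lintegral_sum_loadAt_le {S : Schedule m} (hS : IsFeasible I S) :
    (1 / (6 * γ ^ 2)).toNNReal *
      ∫⁻ t in Set.Ici (0 : ℝ), ((∑ i, loadAt γ I (queueTimes hγ I) i t : ℝ≥0) : ℝ≥0∞) ≤
      2 * cost (fun _ s => s ^ γ) I S := by
  have h : Set.Ici (0 : ℝ) = ⋃ n : ℕ, Set.Icc (0 : ℝ) n := by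
    ext t
    simp only [Set.mem_Ici, Set.mem_iUnion, Set.mem_Icc, exists_and_left]
    exact ⟨fun h => ⟨h, exists_nat_ge t⟩, fun h => h.1⟩
  rw [h, setLIntegral_iUnion_of_directed]
  · rw [ENNReal.mul_iSup]
    exact iSup_le fun n => lintegral_sum_loadAt_Icc_le hγ I hS n
  · exact Monotone.directed_le fun a b hab => Set.Icc_subset_Icc_right (by exact_mod_cast hab)

/-- The active times of `j` form the interval from its release up to, but excluding, its completion.
-/
lemma flowTime_sched_le (hj : j ∈ I.jobs) :
    flowTime I (sched γ I (queueTimes hγ I)) j ≤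
      volume {t | j ∈ act I (queueTimes hγ I) t} := by
  set c := queueTimes hγ I with hc
  have hmem : ∀ t : ℝ, j ∈ act I c t ↔ (I.release j : ℝ) ≤ t ∧ (t : EReal) < c j := fun t => by
    simp [mem_act, hj]
  rcases eq_or_ne (c j) ⊤ with h | h
  · have : {t | j ∈ act I c t} = Set.Ici (I.release j : ℝ) := by
      ext t
      simp [hmem, h]
    rw [this, Real.volume_Ici]
    exact le_top
  · have hr : ((I.release j : ℝ) : EReal) < c j := by
      rw [← not_le, hc, queueTimes_le_iff hγ hj]
      exact not_completedBy_of_le_release (I.size_pos j hj) le_rfl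
    obtain ⟨x, hx⟩ : ∃ x : ℝ, c j = x := ⟨_, (EReal.coe_toReal h (bot_le.trans_lt hr).ne').symm⟩
    have hrx : (I.release j : ℝ) < x := by
      rw [hx] at hr
      exact EReal.coe_lt_coe_iff.1 hr
    have : {t | j ∈ act I c t} = Set.Ico (I.release j : ℝ) x := by
      ext t
      simp [hmem, hx]
    rw [this, Real.volume_Ico]
    refine (iInf₂_le (x - I.release j).toNNReal ?_).trans le_rfl
    rw [← queueTimes_le_iff hγ hj, ← hc, hx, Real.coe_toNNReal _ (by linarith)]
    simp

/-- The total load is the total active weight, whose integral bounds the weighted flow-time; the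
power of each machine equals its load, so the energy is the same integral. -/
lemma cost_sched_le :
    cost (fun _ s => s ^ γ) I (sched γ I (queueTimes hγ I)) ≤
      2 * ∫⁻ t in Set.Ici (0 : ℝ),
        ((∑ i, loadAt γ I (queueTimes hγ I) i t : ℝ≥0) : ℝ≥0∞) := by
  set c := queueTimes hγ I
  have hm : ∀ j, MeasurableSet {t | j ∈ act I c t} := fun j => by
    by_cases hj : j ∈ I.jobs
    · have : {t | j ∈ act I c t} = Set.Ici (I.release j : ℝ) ∩ {t : ℝ | (t : EReal) < c j} := by
        ext t
        simp [mem_act, hj]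
      rw [this]
      exact measurableSet_Ici.inter (measurableSet_lt measurable_coe_real_ereal measurable_const)
    · have : {t | j ∈ act I c t} = ∅ := by
        ext t
        simp [mem_act, hj]
      rw [this]
      exact MeasurableSet.empty
  have hflow : ∑ j ∈ I.jobs, (I.weight j : ℝ≥0∞) * flowTime I (sched γ I c) j ≤
      ∫⁻ t in Set.Ici (0 : ℝ), ((∑ i, loadAt γ I c i t : ℝ≥0) : ℝ≥0∞) := by
    have h1 : ∀ t, ((∑ i, loadAt γ I c i t : ℝ≥0) : ℝ≥0∞) =
        ∑ j ∈ I.jobs, {t | j ∈ act I c t}.indicator (fun _ => (I.weight j : ℝ≥0∞)) t := by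
      intro t
      have hsub : act I c t ⊆ I.jobs := fun j hj => (mem_act.1 hj).1
      rw [sum_loadAt, ← Finset.sum_subset
          (f := fun j => {t | j ∈ act I c t}.indicator (fun _ => (I.weight j : ℝ≥0∞)) t)
          hsub fun j _ hj => Set.indicator_of_notMem (s := {t | j ∈ act I c t}) hj _,
        Finset.sum_congr rfl fun j hj => Set.indicator_of_mem (s := {t | j ∈ act I c t}) hj _]
      push_cast
      rfl
    simp_rw [h1]
    rw [lintegral_finsetSum _ fun j _ => measurable_const.indicator (hm j)]
    refine Finset.sum_le_sum fun j hj => ?_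
    have hsub : {t | j ∈ act I c t} ⊆ Set.Ici 0 := fun t ht =>
      (I.release j).coe_nonneg.trans (mem_act.1 ht).2.1
    rw [setLIntegral_indicator (hm j), Set.inter_eq_left.2 hsub, setLIntegral_const]
    exact mul_le_mul_right (flowTime_sched_le hγ I hj) _
  have henergy : energy (fun _ s => s ^ γ) (sched γ I c) =
      ∫⁻ t in Set.Ici (0 : ℝ), ((∑ i, loadAt γ I c i t : ℝ≥0) : ℝ≥0∞) := by
    rw [energy, ← lintegral_finsetSum _ fun i _ =>
      ((measurable_speed_sched γ I c i).pow_const _).coe_nnreal_ennreal]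
    refine lintegral_congr fun t => ?_
    push_cast
    refine Finset.sum_congr rfl fun i _ => ?_
    have h : (sched γ I c).speed i t = loadAt γ I c i t ^ (1 / γ) := rfl
    rw [h, ← NNReal.rpow_mul, one_div_mul_cancel (by linarith), NNReal.rpow_one]
  rw [cost, henergy, two_mul]
  gcongr

/-- The constant is `24 = 2 * 6 * 2`: cost against load, the duality gap, and the factor in front of
the offline cost. -/
theorem isCompetitive_queueAlgorithm :
    (queueAlgorithm hγ m).IsCompetitive (fun _ s => s ^ γ) (ENNReal.ofReal (24 * γ ^ 2)) := by
  intro I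
  have h0 : (0 : ℝ) < 24 * γ ^ 2 := by positivity
  have hne : ENNReal.ofReal (24 * γ ^ 2) ≠ 0 := (ENNReal.ofReal_pos.2 h0).ne'
  rw [opt, ENNReal.mul_iInf_of_ne hne ENNReal.ofReal_ne_top]
  refine le_iInf fun S => ?_
  rw [ENNReal.mul_iInf_of_ne hne ENNReal.ofReal_ne_top]
  refine le_iInf fun hS => (cost_sched_le hγ I).trans ?_
  have hinv : ENNReal.ofReal (6 * γ ^ 2) * (1 / (6 * γ ^ 2)).toNNReal = 1 := by
    change ENNReal.ofReal _ * ENNReal.ofReal _ = 1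
    rw [← ENNReal.ofReal_mul (by positivity), mul_one_div_cancel (by positivity),
      ENNReal.ofReal_one]
  set V := ∫⁻ t in Set.Ici (0 : ℝ), ((∑ i, loadAt γ I (queueTimes hγ I) i t : ℝ≥0) : ℝ≥0∞)
  calc 2 * V = 2 * (ENNReal.ofReal (6 * γ ^ 2) * ((1 / (6 * γ ^ 2)).toNNReal * V)) := by
        rw [← mul_assoc (ENNReal.ofReal _), hinv, one_mul]
    _ ≤ 2 * (ENNReal.ofReal (6 * γ ^ 2) * (2 * cost (fun _ s => s ^ γ) I S)) := by
        exact mul_le_mul_right (mul_le_mul_right (lintegral_sum_loadAt_le hγ I hS) _) _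
    _ = ENNReal.ofReal (24 * γ ^ 2) * cost (fun _ s => s ^ γ) I S := by
        have h4 : ENNReal.ofReal (24 * γ ^ 2) = 4 * ENNReal.ofReal (6 * γ ^ 2) := by
          rw [← ENNReal.ofReal_ofNat 4, ← ENNReal.ofReal_mul (by norm_num)]
          congr 1
          ring
        rw [h4]
        ring

end Duality

/-! ### The degenerate case of no machines. -/

/-- Without machines no job is ever completed. -/
noncomputable def idleAlgorithm : NonclairvoyantAlgorithm 0 where
  run _ := ⟨fun _ _ => 0, fun _ _ _ => 0⟩
  feasible _ :=
    { measurable_speed := fun i => i.elim0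
      measurable_share := fun i => i.elim0
      locally_integrable := fun i => i.elim0
      sum_share_le := fun i => i.elim0
      one_machine := fun _ _ i => i.elim0
      share_eq_zero := fun i => i.elim0 }
  nonanticipating _ _ _ _ := ⟨fun i => i.elim0, fun i => i.elim0⟩

/-- With no jobs the cost is zero. Otherwise the optimum is `∞`, and `c ≠ 0` keeps `c * ∞` infinite.
-/
lemma isCompetitive_idleAlgorithm (f : Fin 0 → ℝ≥0 → ℝ≥0) {c : ℝ≥0∞} (hc : c ≠ 0) :
    idleAlgorithm.IsCompetitive f c := by
  intro I
  rcases I.jobs.eq_empty_or_nonempty with h | ⟨j, hj⟩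
  · simp [cost, energy, h]
  · have hopt : opt f I = ∞ := by
      refine top_le_iff.1 (le_iInf₂ fun S _ => ?_)
      have hX : flowTime I S j = ∞ := by
        refine top_le_iff.1 (le_iInf₂ fun d hd => ?_)
        have h2 := hd.2
        simp [work, (I.size_pos j hj).ne'] at h2
      rw [cost, top_le_iff, ENNReal.add_eq_top, ENNReal.sum_eq_top]
      refine Or.inl ⟨j, hj, ?_⟩
      rw [hX]
      exact ENNReal.mul_top (by simpa using (I.weight_pos j hj).ne')
    rw [hopt, ENNReal.mul_top hc]
    exact le_top

end FlowEnergy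

theorem mainTheorem3 :
    ∃ C : ℝ, 0 < C ∧ ∀ γ : ℝ, 1 < γ → ∀ m : ℕ,
      ∃ A : FlowEnergy.NonclairvoyantAlgorithm m,
        A.IsCompetitive (fun _ s => s ^ γ) (ENNReal.ofReal (C * γ ^ 2)) := by
  refine ⟨24, by norm_num, fun γ hγ m => ?_⟩
  rcases Nat.eq_zero_or_pos m with rfl | hm
  · refine ⟨FlowEnergy.idleAlgorithm, FlowEnergy.isCompetitive_idleAlgorithm _ ?_⟩
    exact (ENNReal.ofReal_pos.2 (by positivity)).ne'
  · have : NeZero m := ⟨hm.ne'⟩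
    exact ⟨FlowEnergy.queueAlgorithm hγ m, FlowEnergy.isCompetitive_queueAlgorithm hγ⟩
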